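/- Let $s \ge 2$ be an integer. A collection $\mathcal{L}$ of subsets (called lines) of a finite set $X$ is an \emph{$s$-cover} of $X$ if every two distinct lines in $\mathcal{L}$ have at most one point in common and every $s$-element subset $S \subseteq X$ contains two distinct points that lie in a common line of $\mathcal{L}$. Then there is an integer $n_0(s)$, depending only on $s$, such that the following hold for all $n \ge n_0(s)$ and every set $X$ with $|X| = n$. (1) If $\mathcal{L}$ is an $s$-cover of $X$ and every line in $\mathcal{L}$ has at most $\frac{n-1}{s-1}$ points, then $$|\mathcal{L}| \ge \frac{n-1}{s-1} + s - 1.$$ (2) If $s \ge 3$, $\mathcal{L}$ is an $s$-cover of $X$ and every line in $\mathcal{L}$ has at most $\frac{n-1}{s-1} - 1$ points, then $$|\mathcal{L}| > \frac{n-1}{s-1} + s - 1.$$ (3) If $(s-1) \mid (n-1)$, then the bound in (1) is tight: there is an $s$-cover $\mathcal{L}$ of $X$ all of whose lines have at most $\frac{n-1}{s-1}$ points and with $|\mathcal{L}| = \frac{n-1}{s-1} + s - 1$. Moreover, (4) if $(s-1) \nmid (n-1)$, then the bound in (1) is asymptotically tight as $n \to \infty$: for every $\varepsilon > 0$ there is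 $n_1(s,\varepsilon)$ such that for every $n \ge n_1(s,\varepsilon)$ with $(s-1) \nmid (n-1)$ and every set $X$ with $|X| = n$, there is an $s$-cover $\mathcal{L}$ of $X$ all of whose lines have at most $\frac{n-1}{s-1}$ points and with $|\mathcal{L}| \le (1+\varepsilon)\left(\frac{n-1}{s-1} + s - 1\right)$. -/

import Mathlib

/-- A collection `L` of subsets (lines) of a finite set `X` is an `s`-cover if every two lines
have at most one point in common and every `s`-element subset of `X` contains a pair of distinct
points lying in a common line. -/
structure IsSCover {X : Type*} [DecidableEq X] (s : ℕ) (L : Finset (Finset X)) : Prop where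
  inter_le_one : ∀ A ∈ L, ∀ B ∈ L, A ≠ B → (A ∩ B).card ≤ 1
  exists_pair : ∀ S : Finset X, S.card = s →
    ∃ x ∈ S, ∃ y ∈ S, x ≠ y ∧ ∃ A ∈ L, x ∈ A ∧ y ∈ A

/-! Put n = (s - 1)k + 1 and suppose that lines of at most k points form an s-cover with at most k +
s - 1 lines. Two lines meet at most once, so the squared degrees over a set meeting every line in
O(√k) points sum to at most about k² (`sum_deg_sq_le`). Call a line long if it has at least 48 s² √k
points. An independent set of points of moderate degree off the long lines extends greedily by one
point of each long line (`exists_indep_extension`). Hence, with ℓ long lines, these points (the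
core) have independence number at most r = s - 1 - ℓ, while there are nearly rk of them.

Against this stands `sum_deg_sq_ge`: v points with independence number ρ and only short lines have
squared degrees summing to at least (ρ + 3)/(ρ(ρ + 1)²) v², up to lower order. Private
neighbourhoods of a maximum independent set are cliques, and almost all points of a clique of c
points have degree at least √c. For r ≥ 2 the bound exceeds k² by a factor of about 1 + 1/s², so ℓ ≥
s - 2.

If ℓ = s - 1, the long lines partition all points but one into sets of size k; with fewer than k
further lines, each long line keeps a point on no other line, and these points with the missed one
form an independent set of size s. If ℓ = s - 2, the points off the long lines form a clique of at
least k + 1 points contained in no line, and de Bruijn–Erdős yields as many lines besides the long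
ones. When all lines have at most k - 1 points, more points stay off the long lines: the first case
becomes impossible for s ≥ 3 and the second gives strict inequality.

Equality comes from s - 1 disjoint lines, one of them completed to a near-pencil. The asymptotic
construction uses s - 2 disjoint lines and part of an affine plane whose order is a prime slightly
above a given square root. Such primes exist by `exists_prime_between`, a Wiener–Ikehara style
argument with the Fejér kernel. -/

namespace SCover

/-! ### Lines, degrees and independent sets. -/

set_option linter.unusedSectionVars false

variable {X : Type*} [DecidableEq X]

/-- Two distinct lines have at most one common point. -/
def IsLinear (L : Finset (Finset X)) : Prop :=
  ∀ A ∈ L, ∀ B ∈ L, A ≠ B → (A ∩ B).card ≤ 1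

/-- The lines through a point. -/
def pencil (L : Finset (Finset X)) (x : X) : Finset (Finset X) := L.filter (x ∈ ·)

/-- The number of lines through a point. -/
def deg (L : Finset (Finset X)) (x : X) : ℕ := (pencil L x).card

/-- The points `x` and `y` lie on a common line. -/
def Joined (L : Finset (Finset X)) (x y : X) : Prop := ∃ A ∈ L, x ∈ A ∧ y ∈ A

instance (L : Finset (Finset X)) (x y : X) : Decidable (Joined L x y) := by
  unfold Joined; infer_instance

/-- No two distinct points of `S` are on a common line. -/
def Indep (L : Finset (Finset X)) (S : Finset X) : Prop :=
  ∀ x ∈ S, ∀ y ∈ S, x ≠ y → ¬ Joined L x y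

/-- Any two distinct points of `C` are on a common line. -/
def Clique (L : Finset (Finset X)) (C : Finset X) : Prop :=
  ∀ x ∈ C, ∀ y ∈ C, x ≠ y → Joined L x y

variable {L : Finset (Finset X)}

lemma mem_pencil {x : X} {A : Finset X} : A ∈ pencil L x ↔ A ∈ L ∧ x ∈ A := by
  simp [pencil]

lemma Joined.symm {x y : X} (h : Joined L x y) : Joined L y x := by
  obtain ⟨A, hA, hx, hy⟩ := h
  exact ⟨A, hA, hy, hx⟩

lemma Indep.mono {S T : Finset X} (h : Indep L S) (hT : T ⊆ S) : Indep L T :=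
  fun x hx y hy => h x (hT hx) y (hT hy)

lemma Indep.insert {S : Finset X} {q : X} (h : Indep L S) (hq : ∀ x ∈ S, ¬ Joined L x q) :
    Indep L (insert q S) := by
  intro x hx y hy hxy
  rcases Finset.mem_insert.1 hx with rfl | hxS <;> rcases Finset.mem_insert.1 hy with rfl | hyS
  · exact absurd rfl hxy
  · exact fun hj => hq y hyS hj.symm
  · exact hq x hxS
  · exact h x hxS y hyS hxy

lemma indep_singleton (p : X) : Indep L {p} := by
  intro x hx y hy hxy
  simp only [Finset.mem_singleton] at hx hy
  exact absurd (hx.trans hy.symm) hxy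

lemma indep_pair {p q : X} (h : ¬ Joined L p q) : Indep L {p, q} := by
  have := (indep_singleton (L := L) q).insert (q := p)
    (fun x hx hj => h (by rw [Finset.mem_singleton] at hx; subst hx; exact hj.symm))
  exact this

lemma Indep.card_lt {s : ℕ} (hL : IsSCover s L) {S : Finset X} (hS : Indep L S) : S.card < s := by
  by_contra! h
  obtain ⟨T, hT, hc⟩ := Finset.exists_subset_card_eq h
  obtain ⟨x, hx, y, hy, hxy, A, hA, hxA, hyA⟩ := hL.exists_pair T hc
  exact hS x (hT hx) y (hT hy) hxy ⟨A, hA, hxA, hyA⟩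

/-! ### Counting in linear families and greedy extension. -/

namespace IsLinear

variable (hL : IsLinear L)
include hL

lemma line_unique {A B : Finset X} (hA : A ∈ L) (hB : B ∈ L) {x y : X} (hxy : x ≠ y)
    (hxA : x ∈ A) (hxB : x ∈ B) (hyA : y ∈ A) (hyB : y ∈ B) : A = B := by
  by_contra h
  have := Finset.card_le_one.1 (hL A hA B hB h) x (by simp [*]) y (by simp [*])
  exact hxy this

/-- Squared degrees count ordered pairs of lines through a point: a pair of distinct lines is
counted at most once, a pair (A, A) at most `E` times. -/
lemma sum_deg_sq_le {K : Finset X} {E : ℕ} (hE : ∀ A ∈ L, (A ∩ K).card ≤ E) :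
    ∑ x ∈ K, deg L x ^ 2 ≤ L.card ^ 2 + L.card * E := by
  have h1 : ∀ x ∈ K, deg L x ^ 2 = ∑ A ∈ L, ∑ B ∈ L, if x ∈ A ∩ B then 1 else 0 := by
    intro x _
    rw [sq, deg, pencil, Finset.card_filter, Finset.sum_mul_sum]
    refine Finset.sum_congr rfl fun A _ => Finset.sum_congr rfl fun B _ => ?_
    by_cases hA : x ∈ A <;> by_cases hB : x ∈ B <;> simp [hA, hB]
  rw [Finset.sum_congr rfl h1, Finset.sum_comm]
  calc ∑ A ∈ L, ∑ x ∈ K, ∑ B ∈ L, (if x ∈ A ∩ B then 1 else 0)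
      = ∑ A ∈ L, ∑ B ∈ L, ∑ x ∈ K, (if x ∈ A ∩ B then 1 else 0) :=
        Finset.sum_congr rfl fun A _ => Finset.sum_comm
    _ ≤ ∑ A ∈ L, ∑ B ∈ L, (1 + if A = B then E else 0) := by
        refine Finset.sum_le_sum fun A hA => Finset.sum_le_sum fun B hB => ?_
        rw [← Finset.card_filter]
        split_ifs with hAB
        · subst hAB
          refine le_trans (Finset.card_le_card ?_) (le_trans (hE A hA) (Nat.le_add_left _ _))
          intro x; simp +contextual
        · refine le_trans (Finset.card_le_card ?_) (hL A hA B hB hAB)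
          intro x; simp +contextual
    _ = L.card ^ 2 + L.card * E := by
        simp [Finset.sum_add_distrib, sq]

/-- Each line through `x` differs from `A`, hence meets it at most once. -/
lemma card_nbr_le {x : X} {A : Finset X} (hA : A ∈ L) (hx : x ∉ A) :
    (A.filter (Joined L x)).card ≤ deg L x := by
  have : A.filter (Joined L x) ⊆ (pencil L x).biUnion (fun B => A ∩ B) := by
    intro y hy
    obtain ⟨hyA, B, hB, hxB, hyB⟩ := Finset.mem_filter.1 hy
    exact Finset.mem_biUnion.2 ⟨B, mem_pencil.2 ⟨hB, hxB⟩, by simp [*]⟩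
  refine (Finset.card_le_card this).trans ?_
  have := Finset.card_biUnion_le_card_mul (pencil L x) (fun B => A ∩ B) 1 (by
    intro B hB
    obtain ⟨hB, hxB⟩ := mem_pencil.1 hB
    exact hL A hA B hB (by rintro rfl; exact hx hxB))
  simpa [deg] using this

/-- A common neighbour is the intersection of a line through `p` with a line through `q`; the two
lines differ because `p` and `q` are not joined. -/
lemma card_common_le {p q : X} (hpq : ¬ Joined L p q) (K : Finset X) :
    (K.filter (fun x => Joined L p x ∧ Joined L q x)).card ≤ deg L p * deg L q := by
  have : K.filter (fun x => Joined L p x ∧ Joined L q x) ⊆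
      (pencil L p ×ˢ pencil L q).biUnion (fun B => B.1 ∩ B.2) := by
    intro y hy
    obtain ⟨-, ⟨B, hB, hpB, hyB⟩, C, hC, hqC, hyC⟩ := Finset.mem_filter.1 hy
    exact Finset.mem_biUnion.2 ⟨(B, C), by simp [mem_pencil, *], by simp [*]⟩
  refine (Finset.card_le_card this).trans ?_
  have := Finset.card_biUnion_le_card_mul (pencil L p ×ˢ pencil L q) (fun B => B.1 ∩ B.2) 1 (by
    rintro ⟨B, C⟩ hBC
    simp only [Finset.mem_product, mem_pencil] at hBC
    refine hL B hBC.1.1 C hBC.2.1 ?_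
    rintro rfl
    exact hpq ⟨B, hBC.1.1, hBC.1.2, hBC.2.2⟩)
  simpa [deg] using this

lemma pencil_inter_card_le {p q : X} (hpq : p ≠ q) : (pencil L p ∩ pencil L q).card ≤ 1 := by
  rw [Finset.card_le_one]
  intro A hA B hB
  simp only [Finset.mem_inter, mem_pencil] at hA hB
  exact hL.line_unique hA.1.1 hB.1.1 hpq hA.1.2 hB.1.2 hA.2.2 hB.2.2

/-- A point of low degree on a part `A'` of a line. -/
lemma exists_low_degree {A A' : Finset X} (hA : A ∈ L) (hA' : A' ⊆ A) (hne : A'.Nonempty) :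
    ∃ q ∈ A', A'.card * (deg L q - 1) ≤ L.card := by
  obtain ⟨q, hq, hmin⟩ := Finset.exists_min_image A' (deg L) hne
  refine ⟨q, hq, ?_⟩
  -- Lines other than `A` through different points of `A` are different, so the numbers `deg - 1`
  -- along `A'` add up to at most `L.card`.
  have hdisj : (A' : Set X).PairwiseDisjoint (fun x => (pencil L x).erase A) := by
    intro x hx y hy hxy
    rw [Function.onFun, Finset.disjoint_left]
    intro B hB hB'
    simp only [Finset.mem_erase, mem_pencil] at hB hB'
    exact hB.1 (hL.line_unique hB.2.1 hA hxy hB.2.2 (hA' hx) hB'.2.2 (hA' hy))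
  calc A'.card * (deg L q - 1) = ∑ x ∈ A', (deg L q - 1) := by simp
    _ ≤ ∑ x ∈ A', ((pencil L x).erase A).card := by
        refine Finset.sum_le_sum fun x hx => ?_
        rw [Finset.card_erase_of_mem (mem_pencil.2 ⟨hA, hA' hx⟩)]
        exact Nat.sub_le_sub_right (hmin x hx) 1
    _ = (A'.biUnion (fun x => (pencil L x).erase A)).card := (Finset.card_biUnion hdisj).symm
    _ ≤ L.card := by
        refine Finset.card_le_card fun B hB => ?_
        simp only [Finset.mem_biUnion, Finset.mem_erase, mem_pencil] at hB
        obtain ⟨x, -, -, hB, -⟩ := hB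
        exact hB

/-- An independent set extends by one point from each of a family of long lines. -/
lemma exists_indep_extension {Q y : ℝ} (hQ : 0 < Q) (hb : (L.card : ℝ) ≤ y * Q) (j : ℕ) :
    ∀ (W : Finset (Finset X)), W.card = j → W ⊆ L → ∀ S : Finset X, Indep L S →
      (∀ A ∈ W, Disjoint S A) →
      (∀ A ∈ W, Q + j + ∑ x ∈ S, (deg L x : ℝ) + j * (1 + y) ≤ (A.card : ℝ)) →
      ∃ T, Indep L T ∧ T.card = S.card + j := by
  have hy : 0 ≤ y := by
    by_contra! h
    have := mul_neg_of_neg_of_pos h hQ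
    have h2 : (0 : ℝ) ≤ L.card := Nat.cast_nonneg _
    linarith
  induction j with
  | zero => exact fun W _ _ S hS _ _ => ⟨S, hS, rfl⟩
  | succ j ih =>
    intro W hW hWL S hS hd hc
    obtain ⟨A, hA⟩ : W.Nonempty := Finset.card_pos.1 (by omega)
    have hAL := hWL hA
    -- Discard from `A` the neighbours of `S` and the points on the other chosen lines. At least `Q`
    -- points survive, so one has degree at most `1 + y`; the term `j * (1 + y)` in the size
    -- hypothesis pays for the degrees of the points added.
    set N := S.biUnion (fun x => A.filter (Joined L x)) with hN
    set I := (W.erase A).biUnion (fun B => A ∩ B) with hI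
    have hNc : N.card ≤ ∑ x ∈ S, deg L x := by
      refine Finset.card_biUnion_le.trans (Finset.sum_le_sum fun x hx => ?_)
      exact hL.card_nbr_le hAL (Finset.disjoint_left.1 (hd A hA) hx)
    have hIc : I.card ≤ j := by
      refine (Finset.card_biUnion_le_card_mul (W.erase A) (fun B => A ∩ B) 1 ?_).trans ?_
      · intro B hB
        obtain ⟨hBA, hB⟩ := Finset.mem_erase.1 hB
        exact hL A hAL B (hWL hB) (Ne.symm hBA)
      · rw [Finset.card_erase_of_mem hA, hW]; simp
    set A' := (A \ N) \ I with hA'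
    have hAc : A.card ≤ A'.card + N.card + I.card := by
      have h1 := Finset.le_card_sdiff N A
      have h2 := Finset.le_card_sdiff I (A \ N)
      rw [hA']
      omega
    have hAr : Q ≤ (A'.card : ℝ) := by
      have h1 : (A.card : ℝ) ≤ A'.card + N.card + I.card := by exact_mod_cast hAc
      have h2 : (N.card : ℝ) ≤ ∑ x ∈ S, (deg L x : ℝ) := by exact_mod_cast hNc
      have h3 : (I.card : ℝ) ≤ j := by exact_mod_cast hIc
      have h4 := hc A hA
      push_cast at h4
      nlinarith [mul_nonneg (Nat.cast_nonneg (α := ℝ) j) hy]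
    have hne : A'.Nonempty := by
      rw [← Finset.card_pos]
      exact_mod_cast hQ.trans_le hAr
    obtain ⟨q, hq, hqd⟩ := hL.exists_low_degree hAL (A' := A')
      (Finset.sdiff_subset.trans Finset.sdiff_subset) hne
    simp only [hA', Finset.mem_sdiff] at hq
    obtain ⟨⟨hqA, hqN⟩, hqI⟩ := hq
    have hdq : (deg L q : ℝ) ≤ 1 + y := by
      have h1 : (deg L q : ℝ) - 1 ≤ ((deg L q - 1 : ℕ) : ℝ) := by
        rw [sub_le_iff_le_add]; exact_mod_cast (by omega)
      have h2 : (A'.card : ℝ) * ((deg L q - 1 : ℕ) : ℝ) ≤ y * Q :=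
        le_trans (by exact_mod_cast hqd) hb
      have h3 : Q * ((deg L q - 1 : ℕ) : ℝ) ≤ y * Q :=
        (mul_le_mul_of_nonneg_right hAr (Nat.cast_nonneg _)).trans h2
      have h4 : ((deg L q - 1 : ℕ) : ℝ) ≤ y := by
        rw [mul_comm] at h3
        exact le_of_mul_le_mul_right h3 hQ
      linarith
    have hqS : q ∉ S := fun h => Finset.disjoint_left.1 (hd A hA) h hqA
    have hS' : Indep L (insert q S) := hS.insert fun x hx hj => hqN (by
      rw [hN, Finset.mem_biUnion]
      exact ⟨x, hx, Finset.mem_filter.2 ⟨hqA, hj⟩⟩)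
    obtain ⟨T, hT, hTc⟩ := ih (W.erase A) (by rw [Finset.card_erase_of_mem hA, hW]; simp)
      ((Finset.erase_subset _ _).trans hWL) (insert q S) hS' (by
        intro B hB
        rw [Finset.disjoint_insert_left]
        refine ⟨fun hqB => hqI ?_, hd B (Finset.mem_of_mem_erase hB)⟩
        rw [hI, Finset.mem_biUnion]
        exact ⟨B, hB, Finset.mem_inter.2 ⟨hqA, hqB⟩⟩) (by
        intro B hB
        have h4 := hc B (Finset.mem_of_mem_erase hB)
        rw [Finset.sum_insert hqS]
        push_cast at h4
        nlinarith)
    refine ⟨T, hT, ?_⟩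
    rw [hTc, Finset.card_insert_of_notMem hqS]
    omega

/-- In a clique, all points off a small set have degree at least the square root of the size. -/
lemma exists_exceptional {C : Finset X} (hC : Clique L C) {E : ℕ} (hE1 : 1 ≤ E)
    (hE : ∀ A ∈ L, (A ∩ C).card ≤ E) :
    ∃ Z ⊆ C, Z.card ≤ E ∧ ∀ x ∈ C \ Z, C.card ≤ deg L x ^ 2 := by
  rcases le_or_gt C.card E with h | h
  · exact ⟨C, subset_rfl, h, by simp⟩
  have hne : L.Nonempty := by
    obtain ⟨x, hx, y, hy, hxy⟩ := Finset.one_lt_card.1 (lt_of_le_of_lt hE1 h)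
    obtain ⟨A, hA, -⟩ := hC x hx y hy hxy
    exact ⟨A, hA⟩
  -- The exceptional points are those of a line with the most points of `C`, say m. A point of `C`
  -- off it has degree d ≥ m, and its lines cover the rest of `C` with at most m - 1 points each, so
  -- |C| ≤ d(d - 1) + 1 ≤ d².
  obtain ⟨ℓ, hℓ, hmax⟩ := Finset.exists_max_image L (fun A => (A ∩ C).card) hne
  refine ⟨ℓ ∩ C, Finset.inter_subset_right, hE ℓ hℓ, fun x hx => ?_⟩
  simp only [Finset.mem_sdiff, Finset.mem_inter, not_and] at hx
  obtain ⟨hxC, hxℓ⟩ := hx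
  replace hxℓ : x ∉ ℓ := fun h => hxℓ h hxC
  have h1 : (ℓ ∩ C).card ≤ deg L x := by
    refine (Finset.card_le_card fun y hy => ?_).trans (hL.card_nbr_le hℓ hxℓ)
    obtain ⟨hyℓ, hyC⟩ := Finset.mem_inter.1 hy
    exact Finset.mem_filter.2 ⟨hyℓ, hC x hxC y hyC (by rintro rfl; exact hxℓ hyℓ)⟩
  have h2 : C.erase x ⊆ (pencil L x).biUnion (fun A => (A ∩ C).erase x) := by
    intro y hy
    obtain ⟨hyx, hyC⟩ := Finset.mem_erase.1 hy
    obtain ⟨A, hA, hxA, hyA⟩ := hC x hxC y hyC (Ne.symm hyx)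
    exact Finset.mem_biUnion.2 ⟨A, mem_pencil.2 ⟨hA, hxA⟩, by simp [*]⟩
  have h3 : (C.erase x).card ≤ deg L x * ((ℓ ∩ C).card - 1) := by
    refine (Finset.card_le_card h2).trans (Finset.card_biUnion_le_card_mul _ _ _ fun A hA => ?_)
    obtain ⟨hA, hxA⟩ := mem_pencil.1 hA
    rw [Finset.card_erase_of_mem (Finset.mem_inter.2 ⟨hxA, hxC⟩)]
    exact Nat.sub_le_sub_right (hmax A hA) 1
  rw [Finset.card_erase_of_mem hxC] at h3
  have h5 : deg L x * ((ℓ ∩ C).card - 1) ≤ deg L x * (deg L x - 1) :=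
    Nat.mul_le_mul_left _ (Nat.sub_le_sub_right h1 1)
  have h6 : deg L x ≠ 0 := by
    intro h0
    rw [h0] at h3
    omega
  obtain ⟨d, hd⟩ := Nat.exists_eq_succ_of_ne_zero h6
  rw [hd] at h5 h3 ⊢
  simp only [Nat.succ_eq_add_one, Nat.add_sub_cancel] at h5 h3 ⊢
  have h7 : C.card ≤ (d + 1) * d + 1 := by omega
  nlinarith

end IsLinear

/-! ### Private neighbourhoods of a maximum independent set. -/

/-- The points of `K` joined or equal to `p` but to no other point of `S`. -/
def privateNbrs (L : Finset (Finset X)) (K S : Finset X) (p : X) : Finset X :=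
  K.filter (fun x => (x = p ∨ Joined L p x) ∧ ∀ q ∈ S, q ≠ p → x ≠ q ∧ ¬ Joined L q x)

section

variable {K S : Finset X}

lemma privateNbrs_subset (p : X) : privateNbrs L K S p ⊆ K := Finset.filter_subset _ _

lemma privateNbrs_pairwiseDisjoint :
    (S : Set X).PairwiseDisjoint (privateNbrs L K S) := by
  intro p hp q hq hpq
  rw [Function.onFun, Finset.disjoint_left]
  intro x hx hx'
  simp only [privateNbrs, Finset.mem_filter] at hx hx'
  obtain ⟨-, h1, -⟩ := hx
  obtain ⟨h3, h4⟩ := hx'.2.2 p hp hpq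
  exact h1.elim h3 h4

/-- Two unjoined private neighbours of `p` could replace `p` in `S`, giving a larger independent
set. -/
lemma clique_privateNbrs (hSK : S ⊆ K) (hS : Indep L S)
    (hmax : ∀ T ⊆ K, Indep L T → T.card ≤ S.card) {p : X} (hp : p ∈ S) :
    Clique L (privateNbrs L K S p) := by
  intro x hx y hy hxy
  by_contra hj
  simp only [privateNbrs, Finset.mem_filter] at hx hy
  obtain ⟨hxK, -, hx⟩ := hx
  obtain ⟨hyK, -, hy⟩ := hy
  have h1 : Indep L (insert y (S.erase p)) :=
    (hS.mono (Finset.erase_subset _ _)).insert fun q hq =>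
      (hy q (Finset.mem_of_mem_erase hq) (Finset.ne_of_mem_erase hq)).2
  have h2 : Indep L (insert x (insert y (S.erase p))) := by
    refine h1.insert fun q hq => ?_
    rcases Finset.mem_insert.1 hq with rfl | hq
    · exact fun h => hj h.symm
    · exact (hx q (Finset.mem_of_mem_erase hq) (Finset.ne_of_mem_erase hq)).2
  have hyn : y ∉ S.erase p := fun h =>
    (hy y (Finset.mem_of_mem_erase h) (Finset.ne_of_mem_erase h)).1 rfl
  have hxn : x ∉ insert y (S.erase p) := by
    rw [Finset.mem_insert]
    rintro (h | h)
    · exact hxy h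
    · exact (hx x (Finset.mem_of_mem_erase h) (Finset.ne_of_mem_erase h)).1 rfl
  have h3 := hmax _ (by
    refine Finset.insert_subset hxK (Finset.insert_subset hyK ?_)
    exact (Finset.erase_subset _ _).trans hSK) h2
  rw [Finset.card_insert_of_notMem hxn, Finset.card_insert_of_notMem hyn,
    Finset.card_erase_of_mem hp] at h3
  have := Finset.card_pos.2 ⟨p, hp⟩
  omega

/-- By maximality a point that is private to nobody is joined to at least two points of `S`, and a
pair in `S` has at most `u ^ 2` common neighbours. Pairs are ordered, whence the factor 2. -/
lemma IsLinear.card_le_sum_privateNbrs (hL : IsLinear L) (hSK : S ⊆ K) (hS : Indep L S)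
    (hmax : ∀ T ⊆ K, Indep L T → T.card ≤ S.card) {u : ℕ} (hu : ∀ p ∈ S, deg L p ≤ u) :
    2 * K.card ≤ 2 * ∑ p ∈ S, (privateNbrs L K S p).card + S.card * (S.card - 1) * u ^ 2 := by
  set U := S.biUnion (privateNbrs L K S) with hU
  have hUc : U.card = ∑ p ∈ S, (privateNbrs L K S p).card :=
    Finset.card_biUnion privateNbrs_pairwiseDisjoint
  have hUK : U ⊆ K := Finset.biUnion_subset.2 fun p _ => privateNbrs_subset p
  have hcard : (K \ U).card + U.card = K.card := Finset.card_sdiff_add_card_eq_card hUK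
  have key : 2 * (K \ U).card ≤ ∑ pq ∈ S.offDiag, u ^ 2 := by
    have h1 : ∀ x ∈ K \ U, 2 ≤
        ∑ pq ∈ S.offDiag, if Joined L pq.1 x ∧ Joined L pq.2 x then 1 else 0 := by
      intro x hx
      obtain ⟨hxK, hxU⟩ := Finset.mem_sdiff.1 hx
      simp only [hU, Finset.mem_biUnion, privateNbrs, Finset.mem_filter, not_exists, not_and,
        not_forall] at hxU
      have hxS : x ∉ S := by
        intro hxS
        obtain ⟨q, hq, hqx, h⟩ := hxU x hxS hxK (Or.inl rfl)
        exact h (Ne.symm hqx) (hS q hq x hxS hqx)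
      obtain ⟨p, hp, hpx⟩ : ∃ p ∈ S, Joined L p x := by
        by_contra! h
        have := hmax (insert x S) (Finset.insert_subset hxK hSK) (hS.insert h)
        rw [Finset.card_insert_of_notMem hxS] at this
        omega
      obtain ⟨q, hq, hqp, h⟩ := hxU p hp hxK (Or.inr hpx)
      have hqx : Joined L q x := by
        by_contra hn
        exact h (by rintro rfl; exact hxS hq) hn
      rw [← Finset.card_filter]
      have : ({(p, q), (q, p)} : Finset (X × X)) ⊆
          S.offDiag.filter (fun pq => Joined L pq.1 x ∧ Joined L pq.2 x) := by
        intro z hz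
        simp only [Finset.mem_insert, Finset.mem_singleton] at hz
        rcases hz with rfl | rfl <;> simp [*, Ne.symm hqp]
      refine le_trans ?_ (Finset.card_le_card this)
      rw [Finset.card_pair]
      intro h
      exact hqp (Prod.mk.inj h).2
    calc 2 * (K \ U).card = ∑ x ∈ K \ U, 2 := by simp [mul_comm]
      _ ≤ ∑ x ∈ K \ U, ∑ pq ∈ S.offDiag, (if Joined L pq.1 x ∧ Joined L pq.2 x then 1 else 0) :=
        Finset.sum_le_sum h1
      _ = ∑ pq ∈ S.offDiag, ((K \ U).filter (fun x => Joined L pq.1 x ∧ Joined L pq.2 x)).card := by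
        rw [Finset.sum_comm]
        simp_rw [Finset.card_filter]
      _ ≤ ∑ pq ∈ S.offDiag, u ^ 2 := by
        refine Finset.sum_le_sum fun pq hpq => ?_
        obtain ⟨hp, hq, hne⟩ := Finset.mem_offDiag.1 hpq
        refine (hL.card_common_le (hS _ hp _ hq hne) _).trans ?_
        rw [sq]
        exact Nat.mul_le_mul (hu _ hp) (hu _ hq)
  rw [Finset.sum_const, Finset.offDiag_card, smul_eq_mul, ← Nat.mul_sub_one] at key
  omega

end

end SCover

/-! ### Lower bound for the sum of squared degrees. -/

namespace SCover

set_option linter.unusedSectionVars false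

variable {X : Type*} [DecidableEq X] {L : Finset (Finset X)}

lemma exists_max_indep (L : Finset (Finset X)) (K : Finset X) :
    ∃ S ⊆ K, Indep L S ∧ ∀ T ⊆ K, Indep L T → T.card ≤ S.card := by
  classical
  obtain ⟨S, hS, hmax⟩ := Finset.exists_max_image (K.powerset.filter (Indep L)) Finset.card
    ⟨∅, by simp [Indep]⟩
  simp only [Finset.mem_filter, Finset.mem_powerset] at hS hmax
  exact ⟨S, hS.1, hS.2, fun T hT hi => hmax T ⟨hT, hi⟩⟩

lemma sub_half_mul_eq {v ρ : ℝ} (hρ : 1 ≤ ρ) :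
    ρ * (2 * v / (ρ * (ρ + 1))) / 2 = v / ρ - v / (ρ * (ρ + 1)) := by
  have h1 : ρ ≠ 0 := by linarith
  have h2 : ρ + 1 ≠ 0 := by linarith
  field_simp
  ring

/-- With `t` a squared degree threshold, the left side adds the layer-cake bound below it to the
clique excess above it. The right side decreases in `t` up to 2v/ρ², so on the range t ≤ 2v/(ρ(ρ +
1)) its minimum is at the right end, where `threshold_coeff_eq` evaluates it. -/
lemma layer_add_excess_eq {v ρ t : ℝ} (hρ : 1 ≤ ρ) :
    v * t - ρ * (ρ - 1) * t ^ 2 / 4 + ((v - ρ * (ρ - 1) / 2 * t) ^ 2 / ρ -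
      t * (v - ρ * (ρ - 1) / 2 * t)) = v ^ 2 / ρ ^ 2 + (ρ - 1) * (v / ρ - ρ * t / 2) ^ 2 := by
  have h1 : ρ ≠ 0 := by linarith
  field_simp
  ring

lemma threshold_coeff_eq {v ρ : ℝ} (hρ : 1 ≤ ρ) :
    (ρ + 3) / (ρ * (ρ + 1) ^ 2) * v ^ 2 =
      v ^ 2 / ρ ^ 2 + (ρ - 1) * (v / (ρ * (ρ + 1))) ^ 2 := by
  have h1 : ρ ≠ 0 := by linarith
  have h2 : ρ + 1 ≠ 0 := by linarith
  field_simp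
  ring

/-- At t₀ = 2v/(ρ(ρ + 1)) the layer-cake bound v t - ρ(ρ - 1)t²/4 alone reaches the coefficient; the
remaining terms absorb `E` and the rounding of t₀ to a squared integer. -/
lemma bound_of_layer {v ρ E F t : ℝ} (hρ1 : 1 ≤ ρ) (hv0 : 0 ≤ v) (hE : 0 ≤ E) (hF0 : 0 ≤ F)
    (ht0 : 0 ≤ t) (h1 : t ≤ 2 * v / (ρ * (ρ + 1))) (h2 : 2 * v / (ρ * (ρ + 1)) - 3 * E ≤ t)
    (h3 : v * t ≤ F + ρ * (ρ - 1) * t ^ 2 / 4 + ρ * E * t) :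
    (ρ + 3) / (ρ * (ρ + 1) ^ 2) * v ^ 2 ≤ F + (ρ + 3) * E * v := by
  obtain ⟨t₀, ht₀⟩ : ∃ t₀, t₀ = 2 * v / (ρ * (ρ + 1)) := ⟨_, rfl⟩
  rw [← ht₀] at h1 h2
  have ht₀0 : 0 ≤ t₀ := ht0.trans h1
  have ht₀v : t₀ ≤ v := by
    rw [ht₀, div_le_iff₀ (by positivity), mul_comm 2 v]
    exact mul_le_mul_of_nonneg_left (by nlinarith) hv0
  set f := (ρ + 3) / (2 * (ρ + 1)) * v - ρ * E with hf
  have hf' : f = v - ρ * (ρ - 1) * t₀ / 4 - ρ * E := by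
    rw [hf, ht₀]; field_simp; ring
  have h5 : t * f ≤ F := by
    rw [hf']
    have : 0 ≤ ρ * (ρ - 1) * t * (t₀ - t) :=
      mul_nonneg (mul_nonneg (mul_nonneg (by linarith) (by linarith)) ht0) (by linarith)
    nlinarith
  have h6 : (ρ + 3) / (ρ * (ρ + 1) ^ 2) * v ^ 2 = t₀ * ((ρ + 3) / (2 * (ρ + 1)) * v) := by
    rw [ht₀]; field_simp
  have h7 : (ρ + 3) / (2 * (ρ + 1)) * v ≤ v := by
    refine mul_le_of_le_one_left hv0 ?_
    rw [div_le_one (by positivity)]; linarith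
  rw [h6]
  have h9 : (ρ + 3) / (2 * (ρ + 1)) * v = f + ρ * E := by rw [hf]; ring
  rw [h9] at h7 ⊢
  rcases le_or_gt 0 f with h8 | h8
  · have h10 : (t₀ - 3 * E) * f ≤ t * f := mul_le_mul_of_nonneg_right h2 h8
    have h11 : t₀ * (ρ * E) ≤ v * (ρ * E) := mul_le_mul_of_nonneg_right ht₀v (by positivity)
    have h12 : f ≤ v := by
      have : 0 ≤ ρ * (E : ℝ) := by positivity
      linarith
    have h13 : 3 * E * f ≤ 3 * E * v := mul_le_mul_of_nonneg_left h12 (by positivity)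
    nlinarith
  · have h11 : t₀ * (f + ρ * E) ≤ v * (ρ * E) := by
      calc t₀ * (f + ρ * E) ≤ t₀ * (ρ * E) := mul_le_mul_of_nonneg_left (by linarith) ht₀0
        _ ≤ _ := mul_le_mul_of_nonneg_right ht₀v (by positivity)
    nlinarith [mul_nonneg (by linarith : (0 : ℝ) ≤ E) hv0]

lemma bound_of_excess {v ρ E F t M : ℝ} (hρ1 : 1 ≤ ρ) (hv0 : 0 ≤ v) (hE : 0 ≤ E)
    (ht1 : t ≤ 2 * v / (ρ * (ρ + 1)))
    (h3 : v * t + M ≤ F + ρ * (ρ - 1) * t ^ 2 / 4 + ρ * E * t)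
    (h4 : (v - ρ * (ρ - 1) / 2 * t) ^ 2 / ρ - t * (v - ρ * (ρ - 1) / 2 * t) - E * v ≤ M) :
    (ρ + 3) / (ρ * (ρ + 1) ^ 2) * v ^ 2 ≤ F + (ρ + 3) * E * v := by
  obtain ⟨t₀, ht₀⟩ : ∃ t₀, t₀ = 2 * v / (ρ * (ρ + 1)) := ⟨_, rfl⟩
  rw [← ht₀] at ht1
  have ht₀v : t₀ ≤ v := by
    rw [ht₀, div_le_iff₀ (by positivity), mul_comm 2 v]
    exact mul_le_mul_of_nonneg_left (by nlinarith) hv0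
  have h5 := layer_add_excess_eq (v := v) (t := t) hρ1
  have h6 : v / (ρ * (ρ + 1)) ≤ v / ρ - ρ * t / 2 := by
    have : ρ * t₀ / 2 = v / ρ - v / (ρ * (ρ + 1)) := by rw [ht₀]; exact sub_half_mul_eq hρ1
    have h7 : ρ * t ≤ ρ * t₀ := mul_le_mul_of_nonneg_left ht1 (by linarith)
    linarith
  have h7 : (v / (ρ * (ρ + 1))) ^ 2 ≤ (v / ρ - ρ * t / 2) ^ 2 := by
    gcongr
  have h8 := threshold_coeff_eq (v := v) hρ1
  rw [h8]
  have h9 := mul_le_mul_of_nonneg_left h7 (by linarith : 0 ≤ ρ - 1)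
  have h10 : ρ * E * t ≤ ρ * E * v := mul_le_mul_of_nonneg_left (by linarith) (by positivity)
  have h11 : 0 ≤ E * v := by positivity
  linarith

/-- A discrete layer cake for squares: consecutive odd numbers telescope. -/
lemma sum_odd_ite (d τ : ℕ) :
    ∑ u ∈ Finset.range τ, (if d ≤ u then 2 * (u : ℝ) + 1 else 0) =
      max ((τ : ℝ) ^ 2 - (d : ℝ) ^ 2) 0 := by
  induction τ with
  | zero => simp
  | succ τ ih =>
    rw [Finset.sum_range_succ, ih]
    split_ifs with h
    · have h' : (d : ℝ) ≤ τ := by exact_mod_cast h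
      have h0 : (0 : ℝ) ≤ d := Nat.cast_nonneg d
      rw [max_eq_left (by nlinarith), max_eq_left (by push_cast; nlinarith)]
      push_cast; ring
    · have h' : (τ : ℝ) + 1 ≤ d := by exact_mod_cast (by omega : τ + 1 ≤ d)
      have h0 : (0 : ℝ) ≤ τ := Nat.cast_nonneg τ
      rw [max_eq_right (by nlinarith), max_eq_right (by push_cast; nlinarith)]
      simp

lemma sum_odd_mul_sq_le (τ : ℕ) :
    ∑ u ∈ Finset.range τ, (2 * (u : ℝ) + 1) * (u : ℝ) ^ 2 ≤ (τ : ℝ) ^ 4 / 2 := by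
  induction τ with
  | zero => simp
  | succ τ ih =>
    rw [Finset.sum_range_succ]
    have h0 : (0 : ℝ) ≤ τ := Nat.cast_nonneg τ
    push_cast
    nlinarith [pow_nonneg h0 2]

lemma sum_odd (τ : ℕ) : ∑ u ∈ Finset.range τ, (2 * (u : ℝ) + 1) = (τ : ℝ) ^ 2 := by
  have := sum_odd_ite 0 τ
  simpa using this

namespace IsLinear

variable (hL : IsLinear L)
include hL

/-- There are few points of low degree in a set with small independence number. -/
lemma card_le_of_deg_le {K : Finset X} {E ρ u : ℕ} (hE1 : 1 ≤ E)
    (hE : ∀ A ∈ L, (A ∩ K).card ≤ E) (hρ : ∀ T ⊆ K, Indep L T → T.card < ρ)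
    (hu : ∀ x ∈ K, deg L x ≤ u) :
    2 * (K.card : ℝ) ≤ ρ * (ρ - 1) * (u : ℝ) ^ 2 + 2 * ρ * E := by
  obtain ⟨S, hSK, hS, hmax⟩ := exists_max_indep L K
  -- Either the clique is exhausted by its exceptional points, or a further point of degree at most
  -- `u` bounds its size by `u ^ 2`.
  have hc : ∀ p ∈ S, (privateNbrs L K S p).card ≤ u ^ 2 + E := by
    intro p hp
    obtain ⟨Z, hZ, hZE, h⟩ := hL.exists_exceptional (clique_privateNbrs hSK hS hmax hp) hE1
      (fun A hA => (Finset.card_le_card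
        (Finset.inter_subset_inter_left (privateNbrs_subset p))).trans (hE A hA))
    rcases (privateNbrs L K S p \ Z).eq_empty_or_nonempty with h0 | ⟨x, hx⟩
    · rw [Finset.sdiff_eq_empty_iff_subset] at h0
      exact (Finset.card_le_card h0).trans (hZE.trans (Nat.le_add_left _ _))
    · refine (h x hx).trans (le_trans ?_ (Nat.le_add_right _ _))
      exact Nat.pow_le_pow_left (hu x (privateNbrs_subset p (Finset.sdiff_subset hx))) 2
  have h1 := hL.card_le_sum_privateNbrs hSK hS hmax (u := u) (fun p hp => hu p (hSK hp))
  have h2 : ∑ p ∈ S, (privateNbrs L K S p).card ≤ S.card * (u ^ 2 + E) := by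
    simpa using Finset.sum_le_card_nsmul S _ _ hc
  have h3 : S.card + 1 ≤ ρ := hρ S hSK hS
  have h4 : (2 * K.card : ℝ) ≤ 2 * (S.card * ((u : ℝ) ^ 2 + E)) +
      S.card * (S.card - 1) * (u : ℝ) ^ 2 := by
    have : 2 * K.card + S.card * u ^ 2 ≤ 2 * (S.card * (u ^ 2 + E)) + S.card * S.card * u ^ 2 := by
      rcases Nat.eq_zero_or_pos S.card with h0 | h0
      · simp only [h0, zero_mul, mul_zero, add_zero] at h1 h2 ⊢
        omega
      · obtain ⟨c, hc⟩ := Nat.exists_eq_succ_of_ne_zero h0.ne'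
        rw [hc] at h1 h2 ⊢
        simp only [Nat.succ_eq_add_one, Nat.add_sub_cancel] at h1 h2 ⊢
        nlinarith
    have : (2 * K.card + S.card * (u : ℝ) ^ 2 : ℝ) ≤
        2 * (S.card * ((u : ℝ) ^ 2 + E)) + S.card * S.card * (u : ℝ) ^ 2 := by exact_mod_cast this
    nlinarith
  have h5 : (S.card : ℝ) ≤ ρ - 1 := by
    have : (S.card : ℝ) + 1 ≤ ρ := by exact_mod_cast h3
    linarith
  have h6 : (0 : ℝ) ≤ S.card := Nat.cast_nonneg _
  have h7 : (S.card : ℝ) * (S.card + 1) ≤ ρ * (ρ - 1) := by nlinarith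
  have h8 : (0 : ℝ) ≤ (u : ℝ) ^ 2 := by positivity
  have h9 : (0 : ℝ) ≤ E := Nat.cast_nonneg _
  have h10 := mul_le_mul_of_nonneg_right h7 h8
  have h11 : (S.card : ℝ) * E ≤ ρ * E := mul_le_mul_of_nonneg_right (by linarith) h9
  nlinarith

/-- Layer-cake lower bound for the sum of the squared degrees. -/
lemma sum_deg_sq_ge_of_low {K : Finset X} {E ρ τ : ℕ} (hE1 : 1 ≤ E)
    (hE : ∀ A ∈ L, (A ∩ K).card ≤ E)
    (hρ : ∀ T ⊆ K, (∀ x ∈ T, deg L x < τ) → Indep L T → T.card < ρ) :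
    (K.card : ℝ) * (τ : ℝ) ^ 2 + ∑ x ∈ K, max ((deg L x : ℝ) ^ 2 - (τ : ℝ) ^ 2) 0 ≤
      ∑ x ∈ K, (deg L x : ℝ) ^ 2 + ρ * (ρ - 1) * (τ : ℝ) ^ 4 / 4 + ρ * E * (τ : ℝ) ^ 2 := by
  have hρ0 : (1 : ℝ) ≤ ρ := by
    exact_mod_cast hρ ∅ (by simp) (by simp) (by simp [Indep])
  have hN : ∀ u ∈ Finset.range τ, 2 * ((K.filter (deg L · ≤ u)).card : ℝ) ≤
      ρ * (ρ - 1) * (u : ℝ) ^ 2 + 2 * ρ * E := by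
    intro u hu
    refine hL.card_le_of_deg_le hE1 (fun A hA => (Finset.card_le_card
        (Finset.inter_subset_inter_left (Finset.filter_subset _ _))).trans (hE A hA)) ?_
        (fun x hx => (Finset.mem_filter.1 hx).2)
    intro T hT hi
    refine hρ T (hT.trans (Finset.filter_subset _ _)) (fun x hx => ?_) hi
    exact (Finset.mem_filter.1 (hT hx)).2.trans_lt (Finset.mem_range.1 hu)
  -- The deficit below `τ ^ 2` is summed level by level; the bound of order u² for the number of
  -- points of degree at most u turns into τ⁴.
  have h1 : ∑ x ∈ K, max ((τ : ℝ) ^ 2 - (deg L x : ℝ) ^ 2) 0 =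
      ∑ u ∈ Finset.range τ, (2 * (u : ℝ) + 1) * ((K.filter (deg L · ≤ u)).card : ℝ) := by
    simp_rw [← sum_odd_ite]
    rw [Finset.sum_comm]
    refine Finset.sum_congr rfl fun u _ => ?_
    rw [← Finset.sum_filter, Finset.sum_const, nsmul_eq_mul, mul_comm]
  have h2 : ∑ u ∈ Finset.range τ, (2 * (u : ℝ) + 1) * ((K.filter (deg L · ≤ u)).card : ℝ) ≤
      ρ * (ρ - 1) * (τ : ℝ) ^ 4 / 4 + ρ * E * (τ : ℝ) ^ 2 := by
    calc _ ≤ ∑ u ∈ Finset.range τ, (ρ * (ρ - 1) / 2 * ((2 * (u : ℝ) + 1) * (u : ℝ) ^ 2) +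
          ρ * E * (2 * (u : ℝ) + 1)) := by
          refine Finset.sum_le_sum fun u hu => ?_
          have h3 := hN u hu
          have h4 : (0 : ℝ) ≤ 2 * (u : ℝ) + 1 := by positivity
          nlinarith
      _ = ρ * (ρ - 1) / 2 * ∑ u ∈ Finset.range τ, (2 * (u : ℝ) + 1) * (u : ℝ) ^ 2 +
          ρ * E * (τ : ℝ) ^ 2 := by
          rw [Finset.sum_add_distrib, ← Finset.mul_sum, ← Finset.mul_sum, sum_odd]
      _ ≤ _ := by
          have h5 : (0 : ℝ) ≤ ρ * (ρ - 1) / 2 := by nlinarith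
          have := mul_le_mul_of_nonneg_left (sum_odd_mul_sq_le τ) h5
          linarith
  have h3 : ∑ x ∈ K, (deg L x : ℝ) ^ 2 = (K.card : ℝ) * (τ : ℝ) ^ 2 -
      ∑ x ∈ K, max ((τ : ℝ) ^ 2 - (deg L x : ℝ) ^ 2) 0 +
      ∑ x ∈ K, max ((deg L x : ℝ) ^ 2 - (τ : ℝ) ^ 2) 0 := by
    rw [← nsmul_eq_mul, ← Finset.sum_const, ← Finset.sum_sub_distrib, ← Finset.sum_add_distrib]
    refine Finset.sum_congr rfl fun x _ => ?_
    rcases le_total ((deg L x : ℝ) ^ 2) ((τ : ℝ) ^ 2) with h | h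
    · rw [max_eq_left (by linarith), max_eq_right (by linarith)]; ring
    · rw [max_eq_right (by linarith), max_eq_left (by linarith)]; ring
  linarith

/-- A clique contains many points of high degree. -/
lemma clique_sum_excess_ge {C : Finset X} (hC : Clique L C) {E : ℕ} (hE1 : 1 ≤ E)
    (hE : ∀ A ∈ L, (A ∩ C).card ≤ E) {t : ℝ} (ht : 0 ≤ t) :
    (C.card : ℝ) ^ 2 - t * C.card - E * C.card ≤ ∑ x ∈ C, max ((deg L x : ℝ) ^ 2 - t) 0 := by
  have h0 : 0 ≤ ∑ x ∈ C, max ((deg L x : ℝ) ^ 2 - t) 0 :=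
    Finset.sum_nonneg fun x _ => le_max_right _ _
  have hc : (0 : ℝ) ≤ C.card := Nat.cast_nonneg _
  have hE0 : (0 : ℝ) ≤ E := Nat.cast_nonneg _
  obtain ⟨Z, hZ, hZE, h⟩ := hL.exists_exceptional hC hE1 hE
  rcases le_or_gt (C.card : ℝ) t with h1 | h1
  · nlinarith [mul_nonneg hE0 hc]
  have hZc : ((C \ Z).card : ℝ) ≥ C.card - E := by
    have h2 := Finset.le_card_sdiff Z C
    have h3 : C.card ≤ (C \ Z).card + E := by omega
    have : (C.card : ℝ) ≤ (C \ Z).card + E := by exact_mod_cast h3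
    linarith
  calc (C.card : ℝ) ^ 2 - t * C.card - E * C.card ≤ (C \ Z).card * ((C.card : ℝ) - t) := by
        nlinarith
    _ = ∑ x ∈ C \ Z, ((C.card : ℝ) - t) := by rw [Finset.sum_const, nsmul_eq_mul]
    _ ≤ ∑ x ∈ C \ Z, max ((deg L x : ℝ) ^ 2 - t) 0 := by
        refine Finset.sum_le_sum fun x hx => le_max_of_le_left ?_
        have : (C.card : ℝ) ≤ (deg L x : ℝ) ^ 2 := by exact_mod_cast h x hx
        linarith
    _ ≤ _ := Finset.sum_le_sum_of_subset_of_nonneg Finset.sdiff_subset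
        fun _ _ _ => le_max_right _ _

/-- The excess of the squared degrees in terms of the size of the set, given a maximum independent
set of points of degree at most `τ`. -/
lemma sum_excess_ge {K S : Finset X} {E τ : ℕ} (hE1 : 1 ≤ E)
    (hE : ∀ A ∈ L, (A ∩ K).card ≤ E) (hSK : S ⊆ K) (hS : Indep L S)
    (hmax : ∀ T ⊆ K, Indep L T → T.card ≤ S.card) (hτ : ∀ p ∈ S, deg L p ≤ τ)
    (hS0 : S.Nonempty) (hτv : (S.card : ℝ) ^ 2 * (τ : ℝ) ^ 2 ≤ 2 * K.card) :
    ((K.card : ℝ) - S.card * (S.card - 1) / 2 * (τ : ℝ) ^ 2) ^ 2 / S.card -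
        (τ : ℝ) ^ 2 * ((K.card : ℝ) - S.card * (S.card - 1) / 2 * (τ : ℝ) ^ 2) - E * K.card ≤
      ∑ x ∈ K, max ((deg L x : ℝ) ^ 2 - (τ : ℝ) ^ 2) 0 := by
  set c : X → ℝ := fun p => ((privateNbrs L K S p).card : ℝ) with hc
  set t := (τ : ℝ) ^ 2 with ht
  set ρ := (S.card : ℝ) with hρ
  have hρ1 : 1 ≤ ρ := by rw [hρ]; exact_mod_cast Finset.card_pos.2 hS0
  have ht0 : 0 ≤ t := by positivity
  have h1 : (K.card : ℝ) - ρ * (ρ - 1) / 2 * t ≤ ∑ p ∈ S, c p := by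
    have := hL.card_le_sum_privateNbrs hSK hS hmax hτ
    have h2 : (2 * K.card : ℝ) ≤ 2 * ∑ p ∈ S, c p + S.card * ((S.card - 1 : ℕ) : ℝ) * t := by
      simp only [hc, ht]; exact_mod_cast this
    rw [Nat.cast_sub (Finset.card_pos.2 hS0)] at h2
    push_cast at h2
    nlinarith
  have h3 : (∑ p ∈ S, c p) ^ 2 ≤ ρ * ∑ p ∈ S, c p ^ 2 := sq_sum_le_card_mul_sum_sq
  have h4 : (∑ p ∈ S, c p : ℝ) ≤ K.card := by
    have : (S.biUnion (privateNbrs L K S)).card ≤ K.card :=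
      Finset.card_le_card (Finset.biUnion_subset.2 fun p _ => privateNbrs_subset p)
    rw [Finset.card_biUnion privateNbrs_pairwiseDisjoint] at this
    simp only [hc]; exact_mod_cast this
  have h5 : ∑ p ∈ S, (c p ^ 2 - t * c p - E * c p) ≤
      ∑ x ∈ K, max ((deg L x : ℝ) ^ 2 - t) 0 := by
    calc _ ≤ ∑ p ∈ S, ∑ x ∈ privateNbrs L K S p, max ((deg L x : ℝ) ^ 2 - t) 0 :=
          Finset.sum_le_sum fun p hp =>
            hL.clique_sum_excess_ge (clique_privateNbrs hSK hS hmax hp) hE1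
              (fun A hA => (Finset.card_le_card
                (Finset.inter_subset_inter_left (privateNbrs_subset p))).trans (hE A hA)) ht0
      _ = ∑ x ∈ S.biUnion (privateNbrs L K S), max ((deg L x : ℝ) ^ 2 - t) 0 :=
          (Finset.sum_biUnion privateNbrs_pairwiseDisjoint).symm
      _ ≤ _ := Finset.sum_le_sum_of_subset_of_nonneg
          (Finset.biUnion_subset.2 fun p _ => privateNbrs_subset p) fun _ _ _ => le_max_right _ _
  rw [Finset.sum_sub_distrib, Finset.sum_sub_distrib, ← Finset.mul_sum, ← Finset.mul_sum] at h5
  set σ := ∑ p ∈ S, c p with hσ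
  have hE0 : (0 : ℝ) ≤ E := Nat.cast_nonneg _
  have h6 : σ ^ 2 / ρ ≤ ∑ p ∈ S, c p ^ 2 := by
    rw [div_le_iff₀ (by linarith)]; linarith
  have h7 : E * σ ≤ E * K.card := mul_le_mul_of_nonneg_left h4 hE0
  set a := (K.card : ℝ) - ρ * (ρ - 1) / 2 * t with ha
  have h8 : ρ * t ≤ 2 * a := by rw [ha]; nlinarith
  -- The function x²/ρ - t x increases from x = ρt/2 on, and `hτv` puts `a` beyond that point, so σ
  -- may be replaced by its lower bound `a`.
  have h9 : a ^ 2 / ρ - t * a ≤ σ ^ 2 / ρ - t * σ := by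
    have : σ ^ 2 / ρ - t * σ - (a ^ 2 / ρ - t * a) = (σ - a) * (σ + a - ρ * t) / ρ := by
      field_simp; ring
    have h10 : 0 ≤ (σ - a) * (σ + a - ρ * t) / ρ :=
      div_nonneg (mul_nonneg (by linarith) (by linarith)) (by linarith)
    linarith
  linarith

/-- Lower bound for the sum of the squared degrees over a set with independence number `ρ` that
has only short lines. -/
theorem sum_deg_sq_ge {K S : Finset X} {E : ℕ} (hE1 : 1 ≤ E)
    (hE : ∀ A ∈ L, (A ∩ K).card ≤ E)
    (hmax : ∀ T ⊆ K, Indep L T → T.card ≤ S.card) (hS0 : S.Nonempty) (hKE : K.card ≤ E ^ 2) :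
    ((S.card : ℝ) + 3) / (S.card * ((S.card : ℝ) + 1) ^ 2) * (K.card : ℝ) ^ 2 ≤
      ∑ x ∈ K, (deg L x : ℝ) ^ 2 + ((S.card : ℝ) + 3) * E * K.card := by
  set v := (K.card : ℝ) with hv
  set ρ := (S.card : ℝ) with hρ
  have hρ1 : 1 ≤ ρ := by rw [hρ]; exact_mod_cast Finset.card_pos.2 hS0
  have hv0 : 0 ≤ v := Nat.cast_nonneg _
  have hE0 : (1 : ℝ) ≤ E := by exact_mod_cast hE1
  set F := ∑ x ∈ K, (deg L x : ℝ) ^ 2 with hF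
  have hF0 : 0 ≤ F := Finset.sum_nonneg fun _ _ => by positivity
  set t₀ := 2 * v / (ρ * (ρ + 1)) with ht₀
  have ht₀0 : 0 ≤ t₀ := by positivity
  have ht₀v : t₀ ≤ v := by
    rw [ht₀, div_le_iff₀ (by positivity), mul_comm 2 v]
    exact mul_le_mul_of_nonneg_left (by nlinarith) hv0
  have ht₀e : ρ * (ρ + 1) * t₀ = 2 * v := by rw [ht₀]; field_simp
  set τ₀ := ⌊√t₀⌋₊ with hτ₀
  have h1 : (τ₀ : ℝ) ^ 2 ≤ t₀ := by
    calc (τ₀ : ℝ) ^ 2 ≤ √t₀ ^ 2 := by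
          gcongr; exact Nat.floor_le (Real.sqrt_nonneg _)
      _ = t₀ := Real.sq_sqrt ht₀0
  have hτE : (τ₀ : ℝ) ≤ E := by
    have h2 : v ≤ (E : ℝ) ^ 2 := by rw [hv]; exact_mod_cast hKE
    nlinarith [(Nat.cast_nonneg τ₀ : (0 : ℝ) ≤ τ₀)]
  -- Rounding costs less than 2τ₀ + 1 ≤ 3E; this is where `hKE` matters.
  have h2 : t₀ - 3 * E ≤ (τ₀ : ℝ) ^ 2 := by
    have h3 : √t₀ < τ₀ + 1 := Nat.lt_floor_add_one _
    have h4 : t₀ < ((τ₀ : ℝ) + 1) ^ 2 := by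
      rw [← Real.sqrt_lt' (by positivity)]; exact h3
    nlinarith
  by_cases hcase : ∀ T ⊆ K, (∀ x ∈ T, deg L x < τ₀) → Indep L T → T.card < S.card
  · have h3 := hL.sum_deg_sq_ge_of_low hE1 hE hcase
    have h4 : 0 ≤ ∑ x ∈ K, max ((deg L x : ℝ) ^ 2 - (τ₀ : ℝ) ^ 2) 0 :=
      Finset.sum_nonneg fun x _ => le_max_right _ _
    rw [← hF, ← hv, ← hρ] at h3
    set t := (τ₀ : ℝ) ^ 2 with ht
    have ht4 : (τ₀ : ℝ) ^ 4 = t ^ 2 := by rw [ht]; ring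
    rw [ht4] at h3
    exact bound_of_layer hρ1 hv0 (by linarith) hF0 (by positivity) h1 h2 (by linarith)
  · push Not at hcase
    have hex : ∃ τ, ∃ T ⊆ K, (∀ x ∈ T, deg L x ≤ τ) ∧ Indep L T ∧ S.card ≤ T.card := by
      obtain ⟨T, hT, hd, hi, hc⟩ := hcase
      exact ⟨τ₀, T, hT, fun x hx => (hd x hx).le, hi, hc⟩
    classical
    -- For the least degree bound τ that admits an independent set of full size, minimality feeds
    -- the layer cake below τ, and the set `T` itself supplies the cliques whose degrees exceed τ.
    obtain ⟨T, hTK, hTd, hTi, hTc⟩ := Nat.find_spec hex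
    have hmin := fun m => Nat.find_min (m := m) hex
    set τ := Nat.find hex with hτ
    have hττ₀ : τ ≤ τ₀ := by
      obtain ⟨T, hT, hd, hi, hc⟩ := hcase
      exact Nat.find_min' hex ⟨T, hT, fun x hx => (hd x hx).le, hi, hc⟩
    have hTS : T.card = S.card := le_antisymm (hmax T hTK hTi) hTc
    have h3 := hL.sum_deg_sq_ge_of_low (ρ := S.card) (τ := τ) hE1 hE (by
      intro U hU hd hi
      by_contra! hc
      have hU0 : U.Nonempty := Finset.card_pos.1 ((Finset.card_pos.2 hS0).trans_le hc)
      obtain ⟨x, hx⟩ := hU0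
      have := hd x hx
      exact hmin (τ - 1) (by omega) ⟨U, hU, fun x hx => by have := hd x hx; omega, hi, hc⟩)
    have ht1 : (τ : ℝ) ^ 2 ≤ t₀ := by
      refine le_trans ?_ h1
      gcongr
    have h4 := hL.sum_excess_ge (S := T) (τ := τ) hE1 hE hTK hTi (by rwa [hTS]) hTd
      (Finset.card_pos.1 (by rw [hTS]; exact Finset.card_pos.2 hS0)) (by
        rw [hTS, ← hρ, ← hv, ← ht₀e]
        calc ρ ^ 2 * (τ : ℝ) ^ 2 ≤ ρ ^ 2 * t₀ := mul_le_mul_of_nonneg_left ht1 (by positivity)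
          _ ≤ ρ * (ρ + 1) * t₀ := mul_le_mul_of_nonneg_right (by linarith) ht₀0)
    rw [hTS, ← hρ, ← hv] at h4
    rw [← hF, ← hv, ← hρ] at h3
    set t := (τ : ℝ) ^ 2 with ht
    have ht4 : (τ : ℝ) ^ 4 = t ^ 2 := by rw [ht]; ring
    rw [ht4] at h3
    have ht0 : 0 ≤ t := by positivity
    exact bound_of_excess hρ1 hv0 (by linarith) ht1 h3 h4

end IsLinear

end SCover

/-! ### De Bruijn–Erdős, pencils, and the numerical gain. -/

namespace SCover

set_option linter.unusedSectionVars false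

section

variable {X : Type*} [DecidableEq X] {L : Finset (Finset X)}

/-- **De Bruijn–Erdős** for a clique not contained in a line. -/
lemma IsLinear.card_clique_le (hL : IsLinear L) {C : Finset X} (hC : Clique L C)
    (h2 : 2 ≤ C.card) (hn : ∀ A ∈ L, ¬ C ⊆ A) :
    C.card ≤ (L.filter (fun A => (A ∩ C).Nonempty)).card := by
  let P := {x // x ∈ C}
  let Λ := {A // A ∈ L.filter (fun A => (A ∩ C).Nonempty)}
  let _ : Membership P Λ := ⟨fun A x => x.1 ∈ A.1⟩
  have hmem : ∀ (x : P) (A : Λ), x ∈ A ↔ x.1 ∈ A.1 := fun _ _ => Iff.rfl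
  have hline : ∀ {x y : P}, x ≠ y → ∃ A : Λ, x ∈ A ∧ y ∈ A := by
    intro x y hxy
    obtain ⟨A, hA, hx, hy⟩ := hC x.1 x.2 y.1 y.2 (fun h => hxy (Subtype.ext h))
    exact ⟨⟨A, Finset.mem_filter.2 ⟨hA, x.1, Finset.mem_inter.2 ⟨hx, x.2⟩⟩⟩, hx, hy⟩
  have hΛ : ∀ A : Λ, A.1 ∈ L := fun A => (Finset.mem_filter.1 A.2).1
  have huniq : ∀ {x y : P} {A B : Λ}, x ∈ A → y ∈ A → x ∈ B → y ∈ B → x = y ∨ A = B := by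
    intro x y A B hxA hyA hxB hyB
    by_cases hxy : x = y
    · exact Or.inl hxy
    · exact Or.inr (Subtype.ext (hL.line_unique (hΛ A) (hΛ B)
        (fun h => hxy (Subtype.ext h)) hxA hxB hyA hyB))
  have hpoint : ∀ A : Λ, ∃ x : P, x ∉ A := by
    intro A
    obtain ⟨x, hxC, hxA⟩ := Finset.not_subset.1 (hn A.1 (hΛ A))
    exact ⟨⟨x, hxC⟩, hxA⟩
  have hnot : ∀ x : P, ∃ A : Λ, x ∉ A := by
    intro x
    -- Take z off the line xy: the line yz misses x.
    obtain ⟨y, hy, hyx⟩ := Finset.exists_mem_ne (by omega : 1 < C.card) x.1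
    obtain ⟨A, hxA, hyA⟩ := hline (x := x) (y := ⟨y, hy⟩) (fun h => hyx (congrArg Subtype.val h).symm)
    obtain ⟨z, hz⟩ := hpoint A
    obtain ⟨B, hyB, hzB⟩ := hline (x := ⟨y, hy⟩) (y := z) (by rintro rfl; exact hz hyA)
    refine ⟨B, fun hxB => ?_⟩
    rcases huniq hxA hyA hxB hyB with h | h
    · exact hyx (congrArg Subtype.val h).symm
    · exact hz (h ▸ hzB)
  let _ : Configuration.HasLines P Λ :=
    { exists_point := hpoint
      exists_line := hnot
      eq_or_eq := huniq
      mkLine := fun h => (hline h).choose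
      mkLine_ax := fun h => (hline h).choose_spec }
  have := Configuration.HasLines.card_le P Λ
  simpa [P, Λ] using this

/-- The lines through two points that are not joined are few in number. -/
lemma deg_add_deg_le {p q : X} (h : ¬ Joined L p q) :
    deg L p + deg L q + (L \ (pencil L p ∪ pencil L q)).card = L.card := by
  have hd : Disjoint (pencil L p) (pencil L q) := by
    rw [Finset.disjoint_left]
    intro A hA hA'
    rw [mem_pencil] at hA hA'
    exact h ⟨A, hA.1, hA.2, hA'.2⟩
  have hs : pencil L p ∪ pencil L q ⊆ L := by
    intro A hA
    rcases Finset.mem_union.1 hA with h | h <;> exact (mem_pencil.1 h).1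
  rw [deg, deg, ← Finset.card_union_of_disjoint hd, add_comm, Finset.card_sdiff_add_card_eq_card hs]

lemma IsLinear.deg_add_deg_le (hL : IsLinear L) {p q : X} (h : p ≠ q) :
    deg L p + deg L q ≤ L.card + 1 := by
  have h1 := Finset.card_union_add_card_inter (pencil L p) (pencil L q)
  have h2 := hL.pencil_inter_card_le h
  have h3 : (pencil L p ∪ pencil L q).card ≤ L.card := by
    refine Finset.card_le_card fun A hA => ?_
    rcases Finset.mem_union.1 hA with h | h <;> exact (mem_pencil.1 h).1
  unfold deg
  omega

/-- Lines through `p` are disjoint apart from `p`, which is counted at most once per line. -/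
lemma IsLinear.sum_pencil_inter_le (hL : IsLinear L) (p : X) (K : Finset X) :
    ∑ A ∈ pencil L p, (A ∩ K).card ≤ K.card + L.card := by
  have h1 : ∑ A ∈ pencil L p, ((A ∩ K).erase p).card ≤ K.card := by
    rw [← Finset.card_biUnion]
    · refine Finset.card_le_card (Finset.biUnion_subset.2 fun A _ => ?_)
      exact (Finset.erase_subset _ _).trans Finset.inter_subset_right
    · intro A hA B hB hAB
      rw [Function.onFun, Finset.disjoint_left]
      intro x hx hx'
      simp only [Finset.mem_erase, Finset.mem_inter] at hx hx'
      rw [Finset.mem_coe, mem_pencil] at hA hB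
      exact hAB (hL.line_unique hA.1 hB.1 hx.1 hx.2.1 hx'.2.1 hA.2 hB.2)
  have h2 : (pencil L p).card ≤ L.card := Finset.card_le_card (Finset.filter_subset _ _)
  calc ∑ A ∈ pencil L p, (A ∩ K).card ≤ ∑ A ∈ pencil L p, (((A ∩ K).erase p).card + 1) :=
        Finset.sum_le_sum fun A _ => by
          have := Finset.pred_card_le_card_erase (s := A ∩ K) (a := p)
          omega
    _ ≤ _ := by
      rw [Finset.sum_add_distrib, Finset.sum_const, smul_eq_mul, mul_one]
      omega

lemma Clique.sq_card_le {K : Finset X} (hK : Clique L K) :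
    K.card ^ 2 ≤ K.card + ∑ A ∈ L, (A ∩ K).card ^ 2 := by
  have h : K.offDiag ⊆ L.biUnion (fun A => (A ∩ K) ×ˢ (A ∩ K)) := by
    rintro ⟨x, y⟩ hxy
    obtain ⟨hx, hy, hne⟩ := Finset.mem_offDiag.1 hxy
    obtain ⟨A, hA, hxA, hyA⟩ := hK x hx y hy hne
    exact Finset.mem_biUnion.2 ⟨A, hA, by simp [Finset.mem_product, *]⟩
  have h1 := (Finset.card_le_card h).trans Finset.card_biUnion_le
  simp only [Finset.offDiag_card, Finset.card_product] at h1
  simp only [sq]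
  omega

/-- Lines meet a clique without long lines in at most about the square root of its size. -/
lemma IsLinear.mul_sq_le_sum_deg_sq (hL : IsLinear L) {K : Finset X} (hK : Clique L K)
    {A : Finset X} (hA : A ∈ L) :
    (K.card - (A ∩ K).card : ℝ) * ((A ∩ K).card : ℝ) ^ 2 ≤ ∑ x ∈ K, (deg L x : ℝ) ^ 2 := by
  have h1 : ∀ x ∈ K \ A, ((A ∩ K).card : ℝ) ^ 2 ≤ (deg L x : ℝ) ^ 2 := by
    intro x hx
    obtain ⟨hxK, hxA⟩ := Finset.mem_sdiff.1 hx
    have : (A ∩ K).card ≤ deg L x := by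
      refine (Finset.card_le_card fun y hy => ?_).trans (hL.card_nbr_le hA hxA)
      obtain ⟨hyA, hyK⟩ := Finset.mem_inter.1 hy
      exact Finset.mem_filter.2 ⟨hyA, hK x hxK y hyK (by rintro rfl; exact hxA hyA)⟩
    gcongr
  have h2 : ((K \ A).card : ℝ) = K.card - (A ∩ K).card := by
    have := Finset.card_sdiff_add_card_inter K A
    rw [Finset.inter_comm] at this
    rw [← this]; push_cast; ring
  rw [← h2, ← nsmul_eq_mul, ← Finset.sum_const]
  exact (Finset.sum_le_sum h1).trans
    (Finset.sum_le_sum_of_subset_of_nonneg Finset.sdiff_subset fun _ _ _ => by positivity)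

end

/-- The gain over k² that excludes fewer than s - 2 long lines. For ρ = r the right side is 1 + (r -
1)/(r + 1)², which exceeds 1 only when r ≥ 2; for ρ < r it is at least 1 + 3/ρ. -/
lemma one_add_inv_sq_le {ρ r s : ℕ} (hρ : 1 ≤ ρ) (hρr : ρ ≤ r) (hr : 2 ≤ r) (hrs : r + 1 ≤ s) :
    1 + 1 / (s : ℝ) ^ 2 ≤ (r : ℝ) ^ 2 * (((ρ : ℝ) + 3) / (ρ * ((ρ : ℝ) + 1) ^ 2)) := by
  have h1 : (1 : ℝ) ≤ ρ := by exact_mod_cast hρ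
  have h2 : (2 : ℝ) ≤ r := by exact_mod_cast hr
  have h3 : (r : ℝ) + 1 ≤ s := by exact_mod_cast hrs
  have hρ0 : (0 : ℝ) < ρ := by linarith
  have hs0 : (0 : ℝ) < s := by linarith
  rcases hρr.eq_or_lt with rfl | h
  · have h4 : (ρ : ℝ) ^ 2 * (((ρ : ℝ) + 3) / (ρ * ((ρ : ℝ) + 1) ^ 2)) =
        1 + (ρ - 1) / ((ρ : ℝ) + 1) ^ 2 := by field_simp; ring
    rw [h4]
    have h5 : 1 / (s : ℝ) ^ 2 ≤ (ρ - 1) / ((ρ : ℝ) + 1) ^ 2 := by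
      gcongr
      linarith
    linarith
  · have h4 : (ρ : ℝ) + 1 ≤ r := by exact_mod_cast h
    have h5 : ((ρ : ℝ) + 1) ^ 2 * (((ρ : ℝ) + 3) / (ρ * ((ρ : ℝ) + 1) ^ 2)) = 1 + 3 / ρ := by
      field_simp
    have h6 : ((ρ : ℝ) + 1) ^ 2 * (((ρ : ℝ) + 3) / (ρ * ((ρ : ℝ) + 1) ^ 2)) ≤
        (r : ℝ) ^ 2 * (((ρ : ℝ) + 3) / (ρ * ((ρ : ℝ) + 1) ^ 2)) := by gcongr
    have h7 : 1 / (s : ℝ) ^ 2 ≤ 3 / ρ := by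
      rw [div_le_div_iff₀ (by positivity) (by positivity)]
      nlinarith
    linarith

end SCover

/-! ### Covers with few lines: long lines, the core, and at least s - 2 long lines. -/

namespace SCover

set_option linter.unusedSectionVars false

variable {X : Type*} [Fintype X] [DecidableEq X] {L : Finset (Finset X)} {s : ℕ} {k w : ℝ}

/-- An `s`-cover of `(s - 1) k + 1` points, for large `k = w ^ 2`, with lines of size at most `k`
and with at most `k + s - 1` lines. -/
structure IsSmallCover (s : ℕ) (L : Finset (Finset X)) (k w : ℝ) : Prop where
  two_le : 2 ≤ s
  cover : IsSCover s L
  card_eq : (Fintype.card X : ℝ) = (s - 1) * k + 1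
  sq_eq : w ^ 2 = k
  large : 48000 * (s : ℝ) ^ 6 ≤ w
  line_le : ∀ A ∈ L, (A.card : ℝ) ≤ k
  card_le : (L.card : ℝ) ≤ k + s - 1

/-- The long lines. -/
noncomputable def longLines (s : ℕ) (L : Finset (Finset X)) (w : ℝ) : Finset (Finset X) :=
  L.filter (fun A => 48 * (s : ℝ) ^ 2 * w ≤ A.card)

/-- The points off the long lines. -/
noncomputable def rest (s : ℕ) (L : Finset (Finset X)) (w : ℝ) : Finset X :=
  Finset.univ \ (longLines s L w).biUnion id

/-- The points of moderate degree off the long lines. -/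
noncomputable def core (s : ℕ) (L : Finset (Finset X)) (w : ℝ) : Finset X :=
  (rest s L w).filter (fun x => (deg L x : ℝ) ≤ 40 * s * w)

lemma longLines_subset : longLines s L w ⊆ L := Finset.filter_subset _ _

lemma core_subset : core s L w ⊆ rest s L w := Finset.filter_subset _ _

lemma disjoint_rest {A : Finset X} (hA : A ∈ longLines s L w) : Disjoint (rest s L w) A := by
  rw [Finset.disjoint_left]
  intro x hx hxA
  exact (Finset.mem_sdiff.1 hx).2 (Finset.mem_biUnion.2 ⟨A, hA, hxA⟩)

/-- The relative gain y = 1/s² outweighs both the loss y/1600 in the size of the core and the error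
3y/1000 in the upper bound. -/
lemma false_of_sq_bound {k y e v β r σ : ℝ} (hk : 0 < k) (hy0 : 0 < y) (hy1 : y ≤ 1 / 4)
    (hβ0 : 0 ≤ β) (hr : 0 ≤ r) (hvr : r * k * (1 - y / 1600) ≤ v) (hβ : 1 + y ≤ r ^ 2 * β)
    (g2 : β * v ^ 2 ≤ k ^ 2 + 3 * σ ^ 2 * e * k) (g4 : 1000 * σ ^ 2 * e ≤ k * y) : False := by
  have g5 : 3 * σ ^ 2 * e * k ≤ 3 * (k * y / 1000) * k := by
    have : σ ^ 2 * e ≤ k * y / 1000 := by linarith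
    have := mul_le_mul_of_nonneg_right this hk.le
    linarith
  have g0 : 0 ≤ 1 - y / 1600 := by linarith
  have g6 : (r * k * (1 - y / 1600)) ^ 2 ≤ v ^ 2 :=
    pow_le_pow_left₀ (mul_nonneg (mul_nonneg hr hk.le) g0) hvr 2
  have g7 : (1 + y) * (k * (1 - y / 1600)) ^ 2 ≤ β * v ^ 2 := by
    calc (1 + y) * (k * (1 - y / 1600)) ^ 2 ≤ r ^ 2 * β * (k * (1 - y / 1600)) ^ 2 :=
          mul_le_mul_of_nonneg_right hβ (sq_nonneg _)
      _ = β * (r * k * (1 - y / 1600)) ^ 2 := by ring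
      _ ≤ _ := mul_le_mul_of_nonneg_left g6 hβ0
  have g8 : (1 + y) * (k * (1 - y / 1600)) ^ 2 ≤ k ^ 2 * (1 + 3 * y / 1000) := by linarith
  have g9 : k ^ 2 * (1 + 3 * y / 1000) < (1 + y) * (k * (1 - y / 1600)) ^ 2 := by
    have : (1 + y) * (k * (1 - y / 1600)) ^ 2 = k ^ 2 * ((1 + y) * (1 - y / 1600) ^ 2) := by ring
    rw [this]
    refine mul_lt_mul_of_pos_left ?_ (by positivity)
    nlinarith [mul_pos hy0 hy0, mul_pos (mul_pos hy0 hy0) hy0]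
  linarith

namespace IsSmallCover

variable (h : IsSmallCover s L k w)
include h

lemma isLinear : IsLinear L := h.cover.inter_le_one

lemma two_le_cast : (2 : ℝ) ≤ s := by exact_mod_cast h.two_le

lemma one_le_w : 1 ≤ w := by
  have h1 := h.two_le_cast
  have h2 : (1 : ℝ) ≤ (s : ℝ) ^ 6 := one_le_pow₀ (by linarith)
  linarith [h.large]

/-- The constant in `large` is 48000 = 1000 · 48 for this inequality: short lines are negligible
against k even after multiplication by s⁴. -/
lemma error_le : 1000 * (s : ℝ) ^ 4 * (48 * (s : ℝ) ^ 2 * w) ≤ k := by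
  rw [← h.sq_eq]
  have h1 := mul_le_mul_of_nonneg_right h.large (by linarith [h.one_le_w] : 0 ≤ w)
  nlinarith

lemma s_le_w : (s : ℝ) ≤ w := by
  have h1 := h.two_le_cast
  have h2 : (s : ℝ) ≤ (s : ℝ) ^ 6 := le_self_pow₀ (by linarith) (by norm_num)
  nlinarith [h.large]

lemma w_le_error : 4 * s * w ≤ 48 * (s : ℝ) ^ 2 * w := by
  have h1 := h.two_le_cast
  have h2 := h.one_le_w
  exact mul_le_mul_of_nonneg_right (by nlinarith) (by linarith)

lemma error_le' : 16000 * (48 * (s : ℝ) ^ 2 * w) ≤ k := by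
  have h1 := h.two_le_cast
  have h2 : (16 : ℝ) ≤ (s : ℝ) ^ 4 := by
    calc (16 : ℝ) = 2 ^ 4 := by norm_num
      _ ≤ _ := by gcongr
  have h3 : 0 ≤ 48 * (s : ℝ) ^ 2 * w := by have := h.one_le_w; positivity
  nlinarith [h.error_le]

lemma card_le_two_mul : (L.card : ℝ) ≤ 2 * w * w := by
  have h1 := h.card_le
  have h2 := h.s_le_w
  have h3 := h.one_le_w
  rw [← h.sq_eq] at h1
  nlinarith

/-- An independent set that is too large in combination with the long lines must have large
total degree. -/
lemma exists_short {S : Finset X} {W : Finset (Finset X)} (hS : Indep L S) (hSB : S ⊆ rest s L w)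
    (hW : W ⊆ longLines s L w) (hWs : W.card ≤ s) (hc : s ≤ S.card + W.card) :
    ∃ A ∈ W, (A.card : ℝ) < ∑ x ∈ S, (deg L x : ℝ) + 8 * s * w := by
  by_contra! hA
  have h1 := h.two_le_cast
  have h2 := h.one_le_w
  -- There are at most 2w² lines, so w surviving points guarantee one of degree at most 1 + 2w. The
  -- total cost w + s + s(1 + 2w) stays below 8sw.
  obtain ⟨T, hT, hTc⟩ := h.isLinear.exists_indep_extension (Q := w) (y := 2 * w) (by linarith)
    h.card_le_two_mul W.card W rfl (hW.trans longLines_subset) S hS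
    (fun A hA => (disjoint_rest (hW hA)).mono_left hSB) (fun A hA' => by
      have h3 := hA A hA'
      have h4 : (W.card : ℝ) ≤ s := by exact_mod_cast hWs
      have h5 : (W.card : ℝ) * (1 + 2 * w) ≤ s * (1 + 2 * w) := by gcongr
      nlinarith)
  have := hT.card_lt h.cover
  omega

lemma card_longLines_lt : (longLines s L w).card < s := by
  by_contra! hc
  obtain ⟨W, hW, hWc⟩ := Finset.exists_subset_card_eq hc
  obtain ⟨A, hA, hlt⟩ := h.exists_short (S := ∅) (by simp [Indep]) (by simp) hW hWc.le (by omega)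
  have h1 := (Finset.mem_filter.1 (hW hA)).2
  have h2 := h.two_le_cast
  have h3 := h.one_le_w
  rw [Finset.sum_empty] at hlt
  nlinarith

/-- The constants 40 and 48 fit here: at most s core points have total degree at most 40s²w, and
40s²w + 8sw ≤ 48s²w, so no long line is short enough to stop the extension. -/
lemma card_add_card_longLines_lt {S : Finset X} (hS : Indep L S) (hSK : S ⊆ core s L w) :
    S.card + (longLines s L w).card < s := by
  by_contra! hc
  obtain ⟨A, hA, hlt⟩ := h.exists_short hS (hSK.trans core_subset) subset_rfl
    h.card_longLines_lt.le hc
  have h1 := (Finset.mem_filter.1 hA).2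
  have h2 := h.two_le_cast
  have h3 := h.one_le_w
  have h4 : ∑ x ∈ S, (deg L x : ℝ) ≤ S.card * (40 * s * w) := by
    rw [← nsmul_eq_mul]
    exact Finset.sum_le_card_nsmul _ _ _ fun x hx => (Finset.mem_filter.1 (hSK hx)).2
  have h5 : (S.card : ℝ) ≤ s := by exact_mod_cast (hS.card_lt h.cover).le
  have h6 : (S.card : ℝ) * (40 * s * w) ≤ s * (40 * s * w) := by gcongr
  nlinarith

lemma card_inter_rest_le {A : Finset X} (hA : A ∈ L) :
    (A ∩ rest s L w).card ≤ ⌊48 * (s : ℝ) ^ 2 * w⌋₊ := by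
  by_cases hl : 48 * (s : ℝ) ^ 2 * w ≤ A.card
  · have := disjoint_rest (Finset.mem_filter.2 ⟨hA, hl⟩ : A ∈ longLines s L w)
    rw [Finset.disjoint_iff_inter_eq_empty, Finset.inter_comm] at this
    simp [this]
  · refine (Finset.card_le_card Finset.inter_subset_left).trans ?_
    exact Nat.le_floor (by linarith)

lemma floor_error_le : (⌊48 * (s : ℝ) ^ 2 * w⌋₊ : ℝ) ≤ 48 * (s : ℝ) ^ 2 * w :=
  Nat.floor_le (by have := h.one_le_w; positivity)

lemma sum_deg_sq_rest_le :
    ∑ x ∈ rest s L w, (deg L x : ℝ) ^ 2 ≤ k ^ 2 + 4 * k * (48 * (s : ℝ) ^ 2 * w) := by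
  have h1 : (∑ x ∈ rest s L w, (deg L x : ℝ) ^ 2) ≤
      (L.card : ℝ) ^ 2 + L.card * (⌊48 * (s : ℝ) ^ 2 * w⌋₊ : ℝ) := by
    exact_mod_cast h.isLinear.sum_deg_sq_le fun A hA => h.card_inter_rest_le hA
  have h2 := h.floor_error_le
  have h3 := h.error_le'
  have h4 := h.w_le_error
  have h5 := h.two_le_cast
  have h6 := h.one_le_w
  have h7 := h.s_le_w
  obtain ⟨e, he⟩ : ∃ e, e = 48 * (s : ℝ) ^ 2 * w := ⟨_, rfl⟩
  rw [← he] at h1 h2 h3 h4 ⊢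
  have h8 : (s : ℝ) ≤ e := by nlinarith
  have h9 : (L.card : ℝ) ≤ k + e := by linarith [h.card_le]
  have h10 : (0 : ℝ) ≤ L.card := Nat.cast_nonneg _
  have h11 : (L.card : ℝ) ^ 2 ≤ (k + e) ^ 2 := by gcongr
  have h12 : (L.card : ℝ) * (⌊e⌋₊ : ℝ) ≤ (k + e) * e :=
    mul_le_mul h9 h2 (Nat.cast_nonneg _) (by linarith)
  have h13 : 0 ≤ e * (k - 2 * e) := mul_nonneg (by linarith) (by linarith)
  nlinarith

lemma sum_deg_sq_core_le :
    ∑ x ∈ core s L w, (deg L x : ℝ) ^ 2 ≤ k ^ 2 + 4 * k * (48 * (s : ℝ) ^ 2 * w) :=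
  (Finset.sum_le_sum_of_subset_of_nonneg core_subset fun _ _ _ => by positivity).trans
    h.sum_deg_sq_rest_le

lemma k_pos : 0 < k := by
  rw [← h.sq_eq]
  have := h.one_le_w
  positivity

/-- A point outside the core contributes more than (40sw)² = 1600s²k to a sum that is at most 2k².
-/
lemma card_rest_sub_core_le :
    800 * (s : ℝ) ^ 2 * ((rest s L w \ core s L w).card : ℝ) ≤ k := by
  have h1 := h.sum_deg_sq_rest_le
  have h2 := h.error_le'
  have h3 := h.k_pos
  have h4 : ((rest s L w \ core s L w).card : ℝ) * (1600 * (s : ℝ) ^ 2 * k) ≤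
      ∑ x ∈ rest s L w, (deg L x : ℝ) ^ 2 := by
    rw [← nsmul_eq_mul, ← Finset.sum_const]
    refine le_trans (Finset.sum_le_sum fun x hx => ?_)
      (Finset.sum_le_sum_of_subset_of_nonneg Finset.sdiff_subset fun _ _ _ => by positivity)
    obtain ⟨hx1, hx2⟩ := Finset.mem_sdiff.1 hx
    simp only [core, Finset.mem_filter, not_and, not_le] at hx2
    have h5 : 40 * s * w < (deg L x : ℝ) := hx2 hx1
    have h6 : 0 ≤ 40 * s * w := by have := h.one_le_w; positivity
    calc 1600 * (s : ℝ) ^ 2 * k = (40 * s * w) ^ 2 := by rw [← h.sq_eq]; ring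
      _ ≤ _ := by gcongr
  have h5 : ((rest s L w \ core s L w).card : ℝ) * (1600 * (s : ℝ) ^ 2 * k) ≤ 2 * k * k := by
    nlinarith
  have h6 : k * (1600 * (s : ℝ) ^ 2 * ((rest s L w \ core s L w).card : ℝ)) ≤ k * (2 * k) := by
    linarith
  have := le_of_mul_le_mul_left h6 h3
  linarith

lemma card_rest_ge {m : ℝ} (hm : ∀ A ∈ longLines s L w, (A.card : ℝ) ≤ m) :
    (s - 1) * k + 1 - (longLines s L w).card * m ≤ (rest s L w).card := by
  have h1 : ((longLines s L w).biUnion id).card ≤ ∑ A ∈ longLines s L w, A.card :=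
    Finset.card_biUnion_le
  have h2 : (∑ A ∈ longLines s L w, (A.card : ℝ)) ≤ (longLines s L w).card * m := by
    rw [← nsmul_eq_mul]
    exact Finset.sum_le_card_nsmul _ _ _ hm
  have h3 := Finset.le_card_sdiff ((longLines s L w).biUnion id) Finset.univ
  rw [Finset.card_univ] at h3
  have h4 : (Fintype.card X : ℝ) ≤ (rest s L w).card + ∑ A ∈ longLines s L w, (A.card : ℝ) := by
    have : Fintype.card X ≤ (rest s L w).card + ∑ A ∈ longLines s L w, A.card := by
      unfold rest
      omega
    exact_mod_cast this
  rw [h.card_eq] at h4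
  linarith

lemma longLine_card_ge {A : Finset X} (hA : A ∈ longLines s L w) :
    (s - (longLines s L w).card) * k + 1 - (rest s L w).card ≤ A.card := by
  have h1 : ((longLines s L w).biUnion id).card ≤ ∑ A ∈ longLines s L w, A.card :=
    Finset.card_biUnion_le
  have h2 : (∑ B ∈ (longLines s L w).erase A, (B.card : ℝ)) ≤
      ((longLines s L w).card - 1) * k := by
    have h0 : (((longLines s L w).erase A).card : ℝ) = (longLines s L w).card - 1 := by
      rw [Finset.card_erase_of_mem hA, Nat.cast_sub (Finset.card_pos.2 ⟨A, hA⟩), Nat.cast_one]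
    rw [← h0, ← nsmul_eq_mul]
    exact Finset.sum_le_card_nsmul _ _ _ fun B hB =>
      h.line_le B (longLines_subset (Finset.mem_of_mem_erase hB))
  have h3 := Finset.le_card_sdiff ((longLines s L w).biUnion id) Finset.univ
  rw [Finset.card_univ] at h3
  have h4 : (Fintype.card X : ℝ) ≤ (rest s L w).card + ∑ A ∈ longLines s L w, (A.card : ℝ) := by
    have : Fintype.card X ≤ (rest s L w).card + ∑ A ∈ longLines s L w, A.card := by
      unfold rest
      omega
    exact_mod_cast this
  rw [h.card_eq, ← Finset.add_sum_erase _ _ hA] at h4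
  linarith

lemma card_core_ge :
    (s - 1) * k + 1 - (longLines s L w).card * k - k / (800 * (s : ℝ) ^ 2) ≤
      (core s L w).card := by
  have h1 := h.card_rest_ge fun A hA => h.line_le A (longLines_subset hA)
  have h2 := h.card_rest_sub_core_le
  have h3 := Finset.card_sdiff_add_card_eq_card (core_subset (s := s) (L := L) (w := w))
  have h4 : ((rest s L w \ core s L w).card : ℝ) + (core s L w).card = (rest s L w).card := by
    exact_mod_cast h3
  have h5 := h.two_le_cast
  have h6 : ((rest s L w \ core s L w).card : ℝ) ≤ k / (800 * (s : ℝ) ^ 2) := by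
    rw [le_div_iff₀ (by positivity)]
    linarith
  linarith

lemma card_le_mul : (Fintype.card X : ℝ) ≤ s * k := by
  rw [h.card_eq]
  have := h.error_le'
  have h2 := h.w_le_error
  have h3 := h.two_le_cast
  have h4 := h.one_le_w
  nlinarith

/-- There are at least `s - 2` long lines. -/
lemma le_card_longLines : s ≤ (longLines s L w).card + 2 := by
  by_contra! hlt
  -- This r bounds the independence number of the core, whose size is nearly at least rk.
  obtain ⟨r, hr⟩ : ∃ r, s = (longLines s L w).card + 1 + r := Nat.exists_eq_add_of_le (by omega)
  have hr2 : 2 ≤ r := by omega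
  have hrR : (s : ℝ) = (longLines s L w).card + 1 + r := by exact_mod_cast hr
  have h2 := h.two_le_cast
  have h3 := h.one_le_w
  have hk := h.k_pos
  have hr2' : (2 : ℝ) ≤ r := by exact_mod_cast hr2
  have hv := h.card_core_ge
  set K := core s L w with hK
  obtain ⟨y, hy⟩ : ∃ y : ℝ, y = 1 / (s : ℝ) ^ 2 := ⟨_, rfl⟩
  have hy0 : 0 < y := by rw [hy]; positivity
  have hy1 : y ≤ 1 / 4 := by
    rw [hy]
    apply one_div_le_one_div_of_le (by norm_num)
    nlinarith
  have hvr : r * k * (1 - y / 1600) ≤ (K.card : ℝ) := by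
    have e1 : k / (800 * (s : ℝ) ^ 2) = k * y / 800 := by rw [hy]; field_simp
    rw [e1] at hv
    have e2 : ((s : ℝ) - 1) * k + 1 - (longLines s L w).card * k = r * k + 1 := by
      rw [hrR]; ring
    rw [e2] at hv
    have e3 : 2 * (k * y) ≤ r * (k * y) := by gcongr
    nlinarith
  have hv0 : 0 < (K.card : ℝ) := by
    have : 0 < r * k * (1 - y / 1600) := by
      have : 0 < 1 - y / 1600 := by linarith
      positivity
    linarith
  obtain ⟨S, hSK, hS, hmax⟩ := exists_max_indep L K
  have hρr : S.card ≤ r := by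
    have := h.card_add_card_longLines_lt hS hSK
    omega
  have hS0 : S.Nonempty := by
    obtain ⟨x, hx⟩ := Finset.card_pos.1 (by exact_mod_cast hv0 : 0 < K.card)
    have := hmax {x} (by simpa using hx) (indep_singleton x)
    rw [Finset.card_singleton] at this
    exact Finset.card_pos.1 this
  have hρ1 : 1 ≤ S.card := Finset.card_pos.2 hS0
  set E := ⌊48 * (s : ℝ) ^ 2 * w⌋₊ with hE
  have hE1 : 1 ≤ E := by
    refine Nat.le_floor ?_
    have := h.w_le_error
    push_cast
    nlinarith
  have hEle := h.floor_error_le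
  rw [← hE] at hEle
  have hKs : (K.card : ℝ) ≤ s * k := by
    refine le_trans ?_ h.card_le_mul
    exact_mod_cast Finset.card_le_univ K
  have hKE : K.card ≤ E ^ 2 := by
    have e1 : 48 * (s : ℝ) ^ 2 * w < E + 1 := Nat.lt_floor_add_one _
    have e2 : s * w ≤ E := by
      have := h.w_le_error
      nlinarith
    have e3 : (K.card : ℝ) ≤ (E : ℝ) ^ 2 := by
      calc (K.card : ℝ) ≤ s * k := hKs
        _ ≤ (s * w) ^ 2 := by
          rw [mul_pow, h.sq_eq]
          exact mul_le_mul_of_nonneg_right (by nlinarith) hk.le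
        _ ≤ _ := by gcongr
    exact_mod_cast e3
  have key := h.isLinear.sum_deg_sq_ge hE1 (fun A hA => (Finset.card_le_card
    (Finset.inter_subset_inter_left core_subset)).trans (h.card_inter_rest_le hA)) hmax hS0 hKE
  have hF := h.sum_deg_sq_core_le
  have hβ := one_add_inv_sq_le hρ1 hρr hr2 (by omega : r + 1 ≤ s)
  rw [← hy] at hβ
  have hρs : (S.card : ℝ) + 3 ≤ 2 * s := by
    have : S.card + 3 ≤ 2 * s := by omega
    exact_mod_cast this
  set β := ((S.card : ℝ) + 3) / (S.card * ((S.card : ℝ) + 1) ^ 2) with hβdef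
  have hβ0 : 0 ≤ β := div_nonneg (by linarith [(Nat.cast_nonneg S.card : (0 : ℝ) ≤ S.card)])
    (mul_nonneg (Nat.cast_nonneg _) (sq_nonneg _))
  have herr := h.error_le
  obtain ⟨e, he⟩ : ∃ e, e = 48 * (s : ℝ) ^ 2 * w := ⟨_, rfl⟩
  rw [← he] at hF herr hEle
  have hs2 : 0 ≤ (s : ℝ) ^ 2 := sq_nonneg _
  have he0 : 0 ≤ e := (Nat.cast_nonneg E).trans hEle
  have g1 : ((S.card : ℝ) + 3) * E * K.card ≤ 2 * s * e * (s * k) :=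
    mul_le_mul (mul_le_mul hρs hEle (Nat.cast_nonneg _) (by linarith)) hKs hv0.le
      (mul_nonneg (by linarith) he0)
  have g3 : 0 ≤ ((s : ℝ) ^ 2 - 4) * (e * k) :=
    mul_nonneg (by nlinarith) (mul_nonneg he0 hk.le)
  have g2 : β * (K.card : ℝ) ^ 2 ≤ k ^ 2 + 3 * (s : ℝ) ^ 2 * e * k := by linarith
  have g4 : 1000 * (s : ℝ) ^ 2 * e ≤ k * y := by
    rw [hy, mul_one_div, le_div_iff₀ (pow_pos (by linarith) 2)]
    linarith
  exact false_of_sq_bound hk hy0 hy1 hβ0 (by linarith) hvr hβ g2 g4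

end IsSmallCover

end SCover

/-! ### The two remaining cases: s - 1 or s - 2 long lines. -/

namespace SCover

set_option linter.unusedSectionVars false

variable {X : Type*} [Fintype X] [DecidableEq X] {L : Finset (Finset X)} {s : ℕ} {k w : ℝ}

namespace IsSmallCover

variable (h : IsSmallCover s L k w)
include h

lemma small_bounds : 8 * s * w ≤ k / 4000 ∧ (s : ℝ) ≤ k / 4000 ∧ 48 * (s : ℝ) ^ 2 * w ≤ k / 4000 ∧
    ((rest s L w \ core s L w).card : ℝ) ≤ k / 3200 := by
  have h1 := h.two_le_cast
  have h2 := h.one_le_w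
  have h3 := h.error_le'
  have h4 := h.w_le_error
  have h5 := h.card_rest_sub_core_le
  have h6 : (0 : ℝ) ≤ ((rest s L w \ core s L w).card : ℝ) := Nat.cast_nonneg _
  have h7 : 4 * ((rest s L w \ core s L w).card : ℝ) ≤
      (s : ℝ) ^ 2 * ((rest s L w \ core s L w).card : ℝ) :=
    mul_le_mul_of_nonneg_right (by nlinarith) h6
  refine ⟨by linarith, by nlinarith, by linarith, by linarith⟩

/-- If there are `s - 1` long lines, then they miss exactly one point. -/
lemma card_rest_eq_one (hlong : (longLines s L w).card + 1 = s) : (rest s L w).card = 1 := by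
  have hs : ((longLines s L w).card : ℝ) + 1 = s := by exact_mod_cast hlong
  obtain ⟨b1, b2, b3, b4⟩ := h.small_bounds
  have hk := h.k_pos
  have hcore : core s L w = ∅ := by
    rw [Finset.eq_empty_iff_forall_notMem]
    intro p hp
    have := h.card_add_card_longLines_lt (indep_singleton (L := L) p) (by simpa using hp)
    rw [Finset.card_singleton] at this
    omega
  rw [hcore, Finset.sdiff_empty] at b4
  have h1 : 1 ≤ (rest s L w).card := by
    have := h.card_rest_ge fun A hA => h.line_le A (longLines_subset hA)
    have h2 : (1 : ℝ) ≤ (rest s L w).card := by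
      rw [← hs] at this
      linarith
    exact_mod_cast h2
  -- Extending {p} along all long lines would give an independent set of size s, so p is joined to
  -- most of some long line, which has almost k points. Two such points would need more lines than
  -- there are.
  have hdeg : ∀ p ∈ rest s L w, 3 / 4 * k ≤ (deg L p : ℝ) := by
    intro p hp
    obtain ⟨A, hA, hlt⟩ := h.exists_short (indep_singleton (L := L) p) (by simpa using hp)
      subset_rfl h.card_longLines_lt.le (by rw [Finset.card_singleton]; omega)
    have := h.longLine_card_ge hA
    rw [Finset.sum_singleton] at hlt
    rw [← hs] at this
    linarith
  by_contra hne
  obtain ⟨p, hp, q, hq, hpq⟩ := Finset.one_lt_card.1 (by omega : 1 < (rest s L w).card)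
  have h3 := h.isLinear.deg_add_deg_le hpq
  have h4 : (deg L p : ℝ) + deg L q ≤ L.card + 1 := by exact_mod_cast h3
  have h5 := hdeg p hp
  have h6 := hdeg q hq
  linarith [h.card_le]

/-- If there are `s - 1` long lines, then they are pairwise disjoint. -/
lemma pairwise_disjoint_longLines (hlong : (longLines s L w).card + 1 = s) {A B : Finset X}
    (hA : A ∈ longLines s L w) (hB : B ∈ longLines s L w) (hAB : A ≠ B) : Disjoint A B := by
  have hs : ((longLines s L w).card : ℝ) + 1 = s := by exact_mod_cast hlong
  rw [Finset.disjoint_left]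
  intro x hxA hxB
  have h1 : (longLines s L w).biUnion id ⊆
      A.erase x ∪ ((longLines s L w).erase A).biUnion id := by
    intro y hy
    obtain ⟨C, hC, hyC⟩ := Finset.mem_biUnion.1 hy
    rw [Finset.mem_union]
    by_cases hCA : C = A
    · subst hCA
      by_cases hyx : y = x
      · subst hyx
        exact Or.inr (Finset.mem_biUnion.2 ⟨B, Finset.mem_erase.2 ⟨Ne.symm hAB, hB⟩, hxB⟩)
      · exact Or.inl (Finset.mem_erase.2 ⟨hyx, hyC⟩)
    · exact Or.inr (Finset.mem_biUnion.2 ⟨C, Finset.mem_erase.2 ⟨hCA, hC⟩, hyC⟩)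
  have h2 := (Finset.card_le_card h1).trans (Finset.card_union_le _ _)
  have h3 : (((longLines s L w).erase A).biUnion id).card ≤
      ∑ C ∈ (longLines s L w).erase A, C.card := Finset.card_biUnion_le
  rw [Finset.card_erase_of_mem hxA] at h2
  have h4 := Finset.le_card_sdiff ((longLines s L w).biUnion id) Finset.univ
  rw [Finset.card_univ] at h4
  have h5 := h.card_rest_eq_one hlong
  have hA0 := Finset.card_pos.2 ⟨x, hxA⟩
  have h6 : Fintype.card X ≤ A.card + ∑ C ∈ (longLines s L w).erase A, C.card := by
    unfold rest at h5
    omega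
  have h7 : (Fintype.card X : ℝ) ≤ A.card + ∑ C ∈ (longLines s L w).erase A, (C.card : ℝ) := by
    exact_mod_cast h6
  rw [Finset.add_sum_erase _ (fun C => (C.card : ℝ)) hA] at h7
  have h8 : (∑ B ∈ longLines s L w, (B.card : ℝ)) ≤ (longLines s L w).card * k := by
    rw [← nsmul_eq_mul]
    exact Finset.sum_le_card_nsmul _ _ _ fun B hB => h.line_le B (longLines_subset hB)
  rw [h.card_eq, ← hs] at h7
  linarith

lemma le_card_of_longLines (hlong : (longLines s L w).card + 1 = s) : k + s - 1 ≤ L.card := by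
  have hs : ((longLines s L w).card : ℝ) + 1 = s := by exact_mod_cast hlong
  by_contra! hlt
  have hrest := h.card_rest_eq_one hlong
  obtain ⟨p, hp⟩ := Finset.card_eq_one.1 hrest
  have hpr : p ∈ rest s L w := by rw [hp]; exact Finset.mem_singleton_self p
  have hextra : ((L \ longLines s L w).card : ℝ) < k := by
    have := Finset.card_sdiff_add_card_eq_card (longLines_subset (s := s) (L := L) (w := w))
    have h1 : ((L \ longLines s L w).card : ℝ) + (longLines s L w).card = L.card := by
      exact_mod_cast this
    linarith
  -- A long line has at least k points here, and each of the fewer than k other lines removes at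
  -- most one of them.
  have hq : ∀ A ∈ longLines s L w, ∃ q ∈ A, ∀ B ∈ L \ longLines s L w, q ∉ B := by
    intro A hA
    have h1 : k ≤ A.card := by
      have := h.longLine_card_ge hA
      rw [hrest, ← hs] at this
      push_cast at this
      linarith
    have h2 : ((L \ longLines s L w).biUnion (fun B => A ∩ B)).card < A.card := by
      have h3 := Finset.card_biUnion_le_card_mul (L \ longLines s L w) (fun B => A ∩ B) 1 (by
        intro B hB
        obtain ⟨hBL, hBl⟩ := Finset.mem_sdiff.1 hB
        exact h.isLinear A (longLines_subset hA) B hBL (by rintro rfl; exact hBl hA))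
      rw [mul_one] at h3
      have h4 : ((L \ longLines s L w).card : ℝ) < A.card := by linarith
      exact h3.trans_lt (by exact_mod_cast h4)
    obtain ⟨q, hqA, hq⟩ := Finset.exists_mem_notMem_of_card_lt_card h2
    refine ⟨q, hqA, fun B hB hqB => hq ?_⟩
    exact Finset.mem_biUnion.2 ⟨B, hB, Finset.mem_inter.2 ⟨hqA, hqB⟩⟩
  have : Nonempty X := ⟨p⟩
  choose! q hqA hqB using hq
  have hline : ∀ A ∈ longLines s L w, ∀ B ∈ L, q A ∈ B → B = A := by
    intro A hA B hB hqAB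
    by_contra hne
    by_cases hBl : B ∈ longLines s L w
    · exact Finset.disjoint_left.1 (h.pairwise_disjoint_longLines hlong hBl hA hne) hqAB (hqA A hA)
    · exact hqB A hA B (Finset.mem_sdiff.2 ⟨hB, hBl⟩) hqAB
  have hinj : Set.InjOn q (longLines s L w) := by
    intro A hA B hB hAB
    exact (hline B hB A (longLines_subset hA) (hAB ▸ hqA A hA))
  have hpq : p ∉ (longLines s L w).image q := by
    intro hp
    obtain ⟨A, hA, rfl⟩ := Finset.mem_image.1 hp
    exact Finset.disjoint_left.1 (disjoint_rest hA) hpr (hqA A hA)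
  have hi : Indep L ((longLines s L w).image q) := by
    intro x hx y hy hxy hj
    obtain ⟨A, hA, rfl⟩ := Finset.mem_image.1 hx
    obtain ⟨B, hB, rfl⟩ := Finset.mem_image.1 hy
    obtain ⟨C, hC, hxC, hyC⟩ := hj
    exact hxy (by rw [← hline A hA C hC hxC, ← hline B hB C hC hyC])
  have hi' : Indep L (insert p ((longLines s L w).image q)) := by
    refine hi.insert fun x hx hj => ?_
    obtain ⟨A, hA, rfl⟩ := Finset.mem_image.1 hx
    obtain ⟨C, hC, hxC, hpC⟩ := hj
    rw [hline A hA C hC hxC] at hpC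
    exact Finset.disjoint_left.1 (disjoint_rest hA) hpr hpC
  have := hi'.card_lt h.cover
  rw [Finset.card_insert_of_notMem hpq, Finset.card_image_of_injOn hinj] at this
  omega

lemma not_subset_of_card {C : Finset X} (hC : C ⊆ rest s L w) (hk : k / 2 ≤ C.card) :
    ∀ A ∈ L, ¬ C ⊆ A := by
  intro A hA hCA
  have h1 : C.card ≤ (A ∩ rest s L w).card :=
    Finset.card_le_card (Finset.subset_inter hCA hC)
  have h2 : (C.card : ℝ) ≤ 48 * (s : ℝ) ^ 2 * w := by
    refine le_trans ?_ h.floor_error_le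
    exact_mod_cast h1.trans (h.card_inter_rest_le hA)
  have := h.small_bounds.2.2.1
  linarith [h.k_pos]

/-- The lines counted by de Bruijn–Erdős meet `C`, whereas long lines miss it, so the two counts
add. -/
lemma card_clique_rest_le {C : Finset X} (hC : C ⊆ rest s L w) (hk : k / 2 ≤ C.card)
    (hcl : Clique L C) : C.card + (longLines s L w).card ≤ L.card := by
  have h2 : 2 ≤ C.card := by
    have h3 := h.error_le'
    have h4 := h.w_le_error
    have h5 := h.two_le_cast
    have h6 := h.one_le_w
    have : (2 : ℝ) ≤ C.card := by nlinarith
    exact_mod_cast this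
  have h1 := h.isLinear.card_clique_le hcl h2 (h.not_subset_of_card hC hk)
  have h3 : L.filter (fun A => (A ∩ C).Nonempty) ⊆ L \ longLines s L w := by
    intro A hA
    obtain ⟨hA, x, hx⟩ := Finset.mem_filter.1 hA
    obtain ⟨hxA, hxC⟩ := Finset.mem_inter.1 hx
    exact Finset.mem_sdiff.2 ⟨hA, fun hAl =>
      Finset.disjoint_left.1 (disjoint_rest hAl) (hC hxC) hxA⟩
  have h4 := Finset.card_le_card h3
  have := Finset.card_sdiff_add_card_eq_card (longLines_subset (s := s) (L := L) (w := w))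
  omega

/-- If there are `s - 2` long lines, then the remaining points form a clique. -/
lemma clique_rest (hlong : (longLines s L w).card + 2 = s) : Clique L (rest s L w) := by
  have hs : ((longLines s L w).card : ℝ) + 2 = s := by exact_mod_cast hlong
  intro p hp q hq hpq
  by_contra hj
  obtain ⟨b1, b2, b3, b4⟩ := h.small_bounds
  have hk := h.k_pos
  set K := core s L w with hK
  -- Two unjoined core points together with s - 2 long lines would violate the greedy bound.
  have hcl : Clique L K := by
    intro x hx y hy hxy
    by_contra hxj
    have := h.card_add_card_longLines_lt (indep_pair hxj) (by
      intro z hz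
      rcases Finset.mem_insert.1 hz with rfl | hz
      · exact hx
      · rw [Finset.mem_singleton.1 hz]; exact hy)
    rw [Finset.card_pair hxy] at this
    omega
  have hrK : ((rest s L w).card : ℝ) ≤ K.card + k / 3200 := by
    have h3 := Finset.card_sdiff_add_card_eq_card (core_subset (s := s) (L := L) (w := w))
    have h4 : ((rest s L w \ core s L w).card : ℝ) + (core s L w).card = (rest s L w).card := by
      exact_mod_cast h3
    linarith
  have hr1 : k + 1 ≤ (rest s L w).card := by
    have := h.card_rest_ge fun A hA => h.line_le A (longLines_subset hA)
    rw [← hs] at this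
    linarith
  have hKL : (K.card : ℝ) ≤ L.card := by
    have := h.card_clique_rest_le core_subset (C := K) (by linarith) hcl
    exact_mod_cast (Nat.le_add_right _ _).trans this
  have hLk : (L.card : ℝ) ≤ k + k / 4000 := by linarith [h.card_le]
  obtain ⟨A, hA, hlt⟩ := h.exists_short (indep_pair hj) (by
      intro z hz
      rcases Finset.mem_insert.1 hz with rfl | hz
      · exact hp
      · rw [Finset.mem_singleton.1 hz]; exact hq)
      subset_rfl h.card_longLines_lt.le (by rw [Finset.card_pair hpq]; omega)
  rw [Finset.sum_pair hpq] at hlt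
  have hAc := h.longLine_card_ge hA
  -- Some long line blocks the extension of {p, q}, and it has nearly k points. As p and q are
  -- unjoined, their pencils are disjoint and use up almost all lines.
  have hdeg : k - k / 500 ≤ (deg L p : ℝ) + deg L q := by
    rw [← hs] at hAc
    linarith
  have hF := h.sum_deg_sq_core_le
  have hmax : ∀ A ∈ L, ((A ∩ K).card : ℝ) ^ 2 ≤ 2 * k := by
    intro A hA
    have h1 := h.isLinear.mul_sq_le_sum_deg_sq hcl hA
    have h2 : ((A ∩ K).card : ℝ) ≤ 48 * (s : ℝ) ^ 2 * w := by
      refine le_trans ?_ h.floor_error_le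
      exact_mod_cast (Finset.card_le_card
        (Finset.inter_subset_inter_left core_subset)).trans (h.card_inter_rest_le hA)
    have h3 : k * (9 / 10) ≤ (K.card : ℝ) - (A ∩ K).card := by linarith
    have h4 : k * (9 / 10) * ((A ∩ K).card : ℝ) ^ 2 ≤ k * (k + 4 * (k / 4000)) := by
      calc k * (9 / 10) * ((A ∩ K).card : ℝ) ^ 2 ≤ _ :=
            mul_le_mul_of_nonneg_right h3 (sq_nonneg _)
        _ ≤ _ := h1
        _ ≤ _ := hF
        _ ≤ _ := by nlinarith
    have h5 : 9 / 10 * ((A ∩ K).card : ℝ) ^ 2 ≤ k + 4 * (k / 4000) := by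
      rw [mul_assoc] at h4
      exact le_of_mul_le_mul_left h4 hk
    linarith
  -- The pairs of the clique `K` cannot all be covered: lines through p or q have few points in `K`
  -- each and linear total size, and the at most k/100 other lines carry at most 2k pairs each. All
  -- together stays below (9k/10)².
  have hpairs : (K.card : ℝ) ^ 2 ≤ K.card + ∑ A ∈ L, ((A ∩ K).card : ℝ) ^ 2 := by
    exact_mod_cast hcl.sq_card_le
  set P := pencil L p ∪ pencil L q with hP
  have hPL : P ⊆ L := by
    intro A hA
    rcases Finset.mem_union.1 hA with h | h <;> exact (mem_pencil.1 h).1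
  have hothers : ∑ A ∈ L \ P, ((A ∩ K).card : ℝ) ^ 2 ≤ k / 100 * (2 * k) := by
    have h1 : ((L \ P).card : ℝ) ≤ k / 100 := by
      have : (deg L p : ℝ) + deg L q + (L \ P).card = L.card := by
        exact_mod_cast deg_add_deg_le hj
      linarith
    calc _ ≤ ((L \ P).card : ℝ) * (2 * k) := by
          rw [← nsmul_eq_mul]
          exact Finset.sum_le_card_nsmul _ _ _ fun A hA => hmax A (Finset.sdiff_subset hA)
      _ ≤ _ := mul_le_mul_of_nonneg_right h1 (by linarith)
  have hpencil : ∀ z, ∑ A ∈ pencil L z, ((A ∩ K).card : ℝ) ^ 2 ≤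
      k / 4000 * (K.card + L.card) := by
    intro z
    have h1 : (∑ A ∈ pencil L z, ((A ∩ K).card : ℝ)) ≤ K.card + L.card := by
      exact_mod_cast h.isLinear.sum_pencil_inter_le z K
    refine le_trans ?_ (mul_le_mul_of_nonneg_left h1 (by linarith))
    rw [Finset.mul_sum]
    refine Finset.sum_le_sum fun A hA => ?_
    rw [sq]
    refine mul_le_mul_of_nonneg_right ?_ (Nat.cast_nonneg _)
    refine le_trans ?_ (h.floor_error_le.trans b3)
    exact_mod_cast (Finset.card_le_card (Finset.inter_subset_inter_left core_subset)).trans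
      (h.card_inter_rest_le (mem_pencil.1 hA).1)
  have hPs : ∑ A ∈ P, ((A ∩ K).card : ℝ) ^ 2 ≤ 2 * (k / 4000 * (K.card + L.card)) := by
    have h1 := Finset.sum_union_inter (s₁ := pencil L p) (s₂ := pencil L q)
      (f := fun A => ((A ∩ K).card : ℝ) ^ 2)
    have h2 : 0 ≤ ∑ A ∈ pencil L p ∩ pencil L q, ((A ∩ K).card : ℝ) ^ 2 :=
      Finset.sum_nonneg fun _ _ => sq_nonneg _
    linarith [hpencil p, hpencil q]
  rw [← Finset.sum_sdiff hPL] at hpairs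
  have hv : k * (9 / 10) ≤ K.card := by linarith
  have hv2 : (k * (9 / 10)) ^ 2 ≤ (K.card : ℝ) ^ 2 := pow_le_pow_left₀ (by linarith) hv 2
  have hk1 : 16000 ≤ k := by
    have h3 := h.error_le'
    have h4 := h.w_le_error
    have h5 := h.two_le_cast
    have h6 := h.one_le_w
    nlinarith
  have hsum : k / 4000 * (K.card + L.card) ≤ k / 4000 * (3 * k) :=
    mul_le_mul_of_nonneg_left (by linarith) (by linarith)
  nlinarith

theorem lower_bound : k + s - 1 ≤ L.card ∧
    (3 ≤ s → ¬ ∀ A ∈ L, (A.card : ℝ) ≤ k - 1) := by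
  have h1 := h.le_card_longLines
  have h2 := h.card_longLines_lt
  rcases (by omega : (longLines s L w).card + 1 = s ∨ (longLines s L w).card + 2 = s) with hl | hl
  · have hs : ((longLines s L w).card : ℝ) + 1 = s := by exact_mod_cast hl
    refine ⟨h.le_card_of_longLines hl, fun h3 hA => ?_⟩
    -- Lines of at most k - 1 points would leave at least s ≥ 3 points off the s - 1 long lines, not
    -- one.
    have h4 := h.card_rest_ge fun A hA' => hA A (longLines_subset hA')
    rw [h.card_rest_eq_one hl, ← hs] at h4
    have h5 : (3 : ℝ) ≤ s := by exact_mod_cast h3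
    push_cast at h4
    linarith
  · have hs : ((longLines s L w).card : ℝ) + 2 = s := by exact_mod_cast hl
    have hk := h.k_pos
    have hr1 : k + 1 ≤ (rest s L w).card := by
      have := h.card_rest_ge fun A hA => h.line_le A (longLines_subset hA)
      rw [← hs] at this
      linarith
    have h3 : ((rest s L w).card : ℝ) + (longLines s L w).card ≤ L.card := by
      exact_mod_cast h.card_clique_rest_le subset_rfl (by linarith) (h.clique_rest hl)
    refine ⟨by linarith, fun hs3 hA => ?_⟩
    -- The clique now has at least k + 1 + (s - 2) points, hence |L| ≥ k + 1 + 2(s - 2).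
    have h4 := h.card_rest_ge fun A hA' => hA A (longLines_subset hA')
    have h5 : (3 : ℝ) ≤ s := by exact_mod_cast hs3
    have h6 := h.card_le
    rw [← hs] at h4
    linarith

end IsSmallCover

/-- The lower bound for the number of lines of an `s`-cover, and the strict lower bound for
shorter lines. -/
theorem card_lower_bound (s : ℕ) (hs : 2 ≤ s) :
    ∃ N : ℕ, ∀ n : ℕ, N ≤ n →
      ∀ (X : Type*) [Fintype X] [DecidableEq X], Fintype.card X = n →
      ∀ L : Finset (Finset X), IsSCover s L →
        ((∀ A ∈ L, (A.card : ℝ) ≤ ((n : ℝ) - 1) / ((s : ℝ) - 1)) →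
          ((n : ℝ) - 1) / ((s : ℝ) - 1) + (s : ℝ) - 1 ≤ (L.card : ℝ)) ∧
        (3 ≤ s → (∀ A ∈ L, (A.card : ℝ) ≤ ((n : ℝ) - 1) / ((s : ℝ) - 1) - 1) →
          ((n : ℝ) - 1) / ((s : ℝ) - 1) + (s : ℝ) - 1 < (L.card : ℝ)) := by
  have hs' : (2 : ℝ) ≤ s := by exact_mod_cast hs
  refine ⟨(48000 * s ^ 6) ^ 2 * s + 1, fun n hn X _ _ hX L hL => ?_⟩
  set k := ((n : ℝ) - 1) / ((s : ℝ) - 1) with hk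
  have hn' : (48000 * (s : ℝ) ^ 6) ^ 2 * s + 1 ≤ n := by exact_mod_cast hn
  have hkn : (n : ℝ) = (s - 1) * k + 1 := by
    rw [hk, mul_div_cancel₀ _ (by linarith)]
    ring
  have hk1 : (48000 * (s : ℝ) ^ 6) ^ 2 ≤ k := by
    rw [hk, le_div_iff₀ (by linarith)]
    have : 0 ≤ (48000 * (s : ℝ) ^ 6) ^ 2 := sq_nonneg _
    nlinarith
  have hk0 : 0 ≤ k := (sq_nonneg _).trans hk1
  have hsmall : (∀ A ∈ L, (A.card : ℝ) ≤ k) → (L.card : ℝ) ≤ k + s - 1 →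
      IsSmallCover s L k (√k) := fun h1 h2 =>
    { two_le := hs
      cover := hL
      card_eq := by rw [hX, hkn]
      sq_eq := Real.sq_sqrt hk0
      large := Real.le_sqrt_of_sq_le hk1
      line_le := h1
      card_le := h2 }
  refine ⟨fun hA => ?_, fun h3 hA => ?_⟩
  · rcases le_total (L.card : ℝ) (k + s - 1) with hle | hle
    · exact (hsmall hA hle).lower_bound.1
    · exact hle
  · by_contra! hle
    exact (hsmall (fun A hA' => (hA A hA').trans (by linarith)) hle).lower_bound.2 h3 hA

end SCover

/-! ### Constructions: near-pencils and affine planes. -/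

namespace SCover

set_option linter.unusedSectionVars false
set_option linter.unusedFintypeInType false
set_option linter.unusedDecidableInType false

section

variable {X Y : Type*} [DecidableEq X] [DecidableEq Y]

/-- The image of a family of lines under a bijection. -/
def mapLines (e : Y ≃ X) (L : Finset (Finset Y)) : Finset (Finset X) :=
  L.map ⟨Finset.map e.toEmbedding, Finset.map_injective _⟩

lemma card_mapLines (e : Y ≃ X) (L : Finset (Finset Y)) : (mapLines e L).card = L.card :=
  Finset.card_map _

lemma mem_mapLines {e : Y ≃ X} {L : Finset (Finset Y)} {A : Finset X} :
    A ∈ mapLines e L ↔ ∃ B ∈ L, B.map e.toEmbedding = A := by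
  simp [mapLines]

lemma _root_.IsSCover.mapLines {s : ℕ} {L : Finset (Finset Y)} (h : IsSCover s L) (e : Y ≃ X) :
    IsSCover s (mapLines e L) where
  inter_le_one := by
    intro A hA B hB hAB
    obtain ⟨A', hA', rfl⟩ := mem_mapLines.1 hA
    obtain ⟨B', hB', rfl⟩ := mem_mapLines.1 hB
    rw [← Finset.map_inter, Finset.card_map]
    exact h.inter_le_one A' hA' B' hB' (by rintro rfl; exact hAB rfl)
  exists_pair := by
    intro S hS
    obtain ⟨x, hx, y, hy, hxy, A, hA, hxA, hyA⟩ :=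
      h.exists_pair (S.map e.symm.toEmbedding) (by rw [Finset.card_map, hS])
    rw [Finset.mem_map_equiv, Equiv.symm_symm] at hx hy
    exact ⟨e x, hx, e y, hy, fun he => hxy (e.injective he), A.map e.toEmbedding,
      mem_mapLines.2 ⟨A, hA, rfl⟩, by simpa using hxA, by simpa using hyA⟩

/-- A linear family is an `s`-cover if the points are partitioned into fewer than `s` classes of
pairwise joined points. -/
lemma isSCover_of_partition {s : ℕ} {L : Finset (Finset Y)} {ι : Type*} [Fintype ι]
    (hL : IsLinear L) (f : Y → ι) (hι : Fintype.card ι < s)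
    (hf : ∀ x y, x ≠ y → f x = f y → Joined L x y) : IsSCover s L where
  inter_le_one := hL
  exists_pair := by
    classical
    intro S hS
    obtain ⟨x, hx, y, hy, hxy, hfxy⟩ := Finset.exists_ne_map_eq_of_card_lt_of_maps_to
      (t := Finset.univ) (by rw [Finset.card_univ, hS]; exact hι) (fun a _ => Finset.mem_univ (f a))
    obtain ⟨A, hA, h⟩ := hf x y hxy hfxy
    exact ⟨x, hx, y, hy, hxy, A, hA, h⟩

end

section

variable (t k : ℕ)

/-- Disjoint lines of equal size. -/
def parallelLines (Z : Type*) [DecidableEq Z] : Finset (Finset ((Fin t × Fin k) ⊕ Z)) :=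
  Finset.univ.image fun i => Finset.univ.image fun j => Sum.inl (i, j)

variable {t k} {Z : Type*} [DecidableEq Z]

lemma mem_parallelLines {A : Finset ((Fin t × Fin k) ⊕ Z)} :
    A ∈ parallelLines t k Z ↔ ∃ i, (Finset.univ.image fun j => Sum.inl (i, j)) = A := by
  simp [parallelLines]

lemma card_of_mem_parallelLines {A : Finset ((Fin t × Fin k) ⊕ Z)}
    (hA : A ∈ parallelLines t k Z) : A.card = k := by
  obtain ⟨i, rfl⟩ := mem_parallelLines.1 hA
  rw [Finset.card_image_of_injective _ (fun a b h => by simpa using h)]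
  simp

lemma isLinear_union {L₁ L₂ : Finset (Finset Z)} (h₁ : IsLinear L₁) (h₂ : IsLinear L₂)
    (h : ∀ A ∈ L₁, ∀ B ∈ L₂, (A ∩ B).card ≤ 1) : IsLinear (L₁ ∪ L₂) := by
  intro A hA B hB hAB
  rcases Finset.mem_union.1 hA with hA | hA <;> rcases Finset.mem_union.1 hB with hB | hB
  · exact h₁ A hA B hB hAB
  · exact h A hA B hB
  · rw [Finset.inter_comm]; exact h B hB A hA
  · exact h₂ A hA B hB hAB

lemma isLinear_parallelLines : IsLinear (parallelLines t k Z) := by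
  intro A hA B hB hAB
  obtain ⟨i, rfl⟩ := mem_parallelLines.1 hA
  obtain ⟨j, rfl⟩ := mem_parallelLines.1 hB
  rw [Finset.card_le_one]
  intro x hx
  simp only [Finset.mem_inter, Finset.mem_image, Finset.mem_univ, true_and] at hx
  obtain ⟨⟨a, rfl⟩, b, hb⟩ := hx
  simp only [Sum.inl.injEq, Prod.mk.injEq] at hb
  exact absurd (by rw [hb.1]) hAB

/-- Tightness of the lower bound: `t` disjoint lines of size `k`, one of which is completed to a
near-pencil by a further point. -/
theorem exists_cover_of_eq (s k : ℕ) (hs : 2 ≤ s) (hk : 2 ≤ k) (X : Type*) [Fintype X]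
    [DecidableEq X] (hX : Fintype.card X = (s - 1) * k + 1) :
    ∃ L : Finset (Finset X), IsSCover s L ∧ (∀ A ∈ L, A.card ≤ k) ∧ L.card = k + (s - 1) := by
  obtain ⟨t, rfl⟩ := Nat.exists_eq_add_of_le' hs
  rw [show t + 2 - 1 = t + 1 by omega] at *
  let Y := (Fin (t + 1) × Fin k) ⊕ Unit
  have e : Y ≃ X := Fintype.equivOfCardEq (by simp [Y, hX])
  let star : Finset (Finset Y) := Finset.univ.image fun j : Fin k => {Sum.inl (0, j), Sum.inr ()}
  have hstar : ∀ A, A ∈ star ↔ ∃ j, ({Sum.inl (0, j), Sum.inr ()} : Finset Y) = A := by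
    intro A; simp [star]
  have hlin : IsLinear (parallelLines (t + 1) k Unit ∪ star) := by
    refine isLinear_union isLinear_parallelLines ?_ ?_
    · intro A hA B hB hAB
      obtain ⟨i, rfl⟩ := (hstar _).1 hA
      obtain ⟨j, rfl⟩ := (hstar _).1 hB
      have hij : i ≠ j := by rintro rfl; exact hAB rfl
      rw [Finset.card_le_one]
      intro x hx y hy
      simp only [Finset.mem_inter, Finset.mem_insert, Finset.mem_singleton] at hx hy
      rcases hx with ⟨rfl | rfl, hx | hx⟩ <;> rcases hy with ⟨rfl | rfl, hy | hy⟩ <;> simp_all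
    · intro A hA B hB
      obtain ⟨i, rfl⟩ := mem_parallelLines.1 hA
      obtain ⟨j, rfl⟩ := (hstar _).1 hB
      rw [Finset.card_le_one]
      intro x hx y hy
      simp only [Finset.mem_inter, Finset.mem_image, Finset.mem_univ, true_and, Finset.mem_insert,
        Finset.mem_singleton] at hx hy
      obtain ⟨⟨a, rfl⟩, hx⟩ := hx
      obtain ⟨⟨b, rfl⟩, hy⟩ := hy
      simp_all
  have hcov : IsSCover (t + 2) (parallelLines (t + 1) k Unit ∪ star) := by
    refine isSCover_of_partition hlin (Sum.elim Prod.fst fun _ => (0 : Fin (t + 1))) (by simp) ?_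
    rintro (⟨i, a⟩ | u) (⟨j, b⟩ | v) hxy hf
    · simp only [Sum.elim_inl] at hf
      subst hf
      exact ⟨_, Finset.mem_union_left _ (mem_parallelLines.2 ⟨i, rfl⟩), by simp, by simp⟩
    · simp only [Sum.elim_inl, Sum.elim_inr] at hf
      subst hf
      exact ⟨_, Finset.mem_union_right _ ((hstar _).2 ⟨a, rfl⟩), by simp, by simp⟩
    · simp only [Sum.elim_inl, Sum.elim_inr] at hf
      subst hf
      exact ⟨_, Finset.mem_union_right _ ((hstar _).2 ⟨b, rfl⟩), by simp, by simp⟩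
    · exact absurd rfl hxy
  refine ⟨mapLines e (parallelLines (t + 1) k Unit ∪ star), hcov.mapLines e, ?_, ?_⟩
  · intro A hA
    obtain ⟨B, hB, rfl⟩ := mem_mapLines.1 hA
    rw [Finset.card_map]
    rcases Finset.mem_union.1 hB with hB | hB
    · exact (card_of_mem_parallelLines hB).le
    · obtain ⟨j, rfl⟩ := (hstar _).1 hB
      exact Finset.card_le_two.trans hk
  · rw [card_mapLines, Finset.card_union_of_disjoint, parallelLines,
      Finset.card_image_of_injective, Finset.card_image_of_injective]
    · simp only [Finset.card_univ, Fintype.card_fin]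
      omega
    · intro i j hij
      have : (Sum.inl (0, i) : Y) ∈ ({Sum.inl (0, j), Sum.inr ()} : Finset Y) := by
        have h : (Sum.inl (0, i) : Y) ∈ ({Sum.inl (0, i), Sum.inr ()} : Finset Y) := by simp
        simpa only [hij] using h
      simpa using this
    · intro i j hij
      have h : (Sum.inl (i, ⟨0, by omega⟩) : Y) ∈
          (Finset.univ.image fun a : Fin k => (Sum.inl (i, a) : Y)) := by simp
      have h' : (Sum.inl (i, ⟨0, by omega⟩) : Y) ∈
          (Finset.univ.image fun a : Fin k => (Sum.inl (j, a) : Y)) := by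
        simpa only [hij] using h
      simp only [Finset.mem_image, Finset.mem_univ, true_and, Sum.inl.injEq, Prod.mk.injEq] at h'
      obtain ⟨a, ha, -⟩ := h'
      exact ha.symm
    · rw [Finset.disjoint_left]
      intro A hA hA'
      obtain ⟨i, rfl⟩ := mem_parallelLines.1 hA
      obtain ⟨j, hj⟩ := (hstar _).1 hA'
      have : (Sum.inr () : Y) ∈ (Finset.univ.image fun a : Fin k => (Sum.inl (i, a) : Y)) := by
        rw [← hj]; simp
      simp at this

end

section

variable {F : Type*} [Field F] [Fintype F] [DecidableEq F]

/-- The points of the affine line with the given parameters: `y = a x + b` or `x = c`. -/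
def OnLine : (F × F) ⊕ F → F × F → Prop
  | Sum.inl ab, z => z.2 = ab.1 * z.1 + ab.2
  | Sum.inr c, z => z.1 = c

instance (l : (F × F) ⊕ F) (z : F × F) : Decidable (OnLine l z) := by
  unfold OnLine
  cases l <;> infer_instance

lemma onLine_unique {l l' : (F × F) ⊕ F} {z z' : F × F} (hz : z ≠ z') (h1 : OnLine l z)
    (h2 : OnLine l z') (h3 : OnLine l' z) (h4 : OnLine l' z') : l = l' := by
  obtain ⟨x, y⟩ := z
  obtain ⟨x', y'⟩ := z'
  rcases l with ⟨a, b⟩ | c <;> rcases l' with ⟨a', b'⟩ | c' <;> simp only [OnLine] at h1 h2 h3 h4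
  · have hx : x - x' ≠ 0 := by
      intro h0
      have : x = x' := sub_eq_zero.1 h0
      exact hz (by rw [h1, h2, this])
    have ha : a = a' := by
      refine mul_right_cancel₀ hx ?_
      linear_combination h3 - h4 - h1 + h2
    subst ha
    have hb : b = b' := by linear_combination h3 - h1
    rw [hb]
  · exact absurd (by rw [h1, h2, h3, h4]) hz
  · exact absurd (by rw [h3, h4, h1, h2]) hz
  · rw [← h1, ← h3]

lemma exists_onLine (z z' : F × F) : ∃ l, OnLine l z ∧ OnLine l z' := by
  obtain ⟨x, y⟩ := z
  obtain ⟨x', y'⟩ := z'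
  by_cases hx : x = x'
  · exact ⟨Sum.inr x, rfl, hx.symm⟩
  · have hx' : x - x' ≠ 0 := sub_ne_zero.2 hx
    refine ⟨Sum.inl ((y - y') / (x - x'), y - (y - y') / (x - x') * x), ?_, ?_⟩
    · simp [OnLine]
    · simp only [OnLine]
      field_simp
      ring

/-- One coordinate determines a point on a line (x on a non-vertical line, y on a vertical one),
which bounds line sizes by |F|. -/
lemma onLine_injOn {l : (F × F) ⊕ F} {z z' : F × F} (h1 : OnLine l z) (h2 : OnLine l z')
    (h : Sum.elim (fun _ => z.1) (fun _ => z.2) l = Sum.elim (fun _ => z'.1) (fun _ => z'.2) l) :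
    z = z' := by
  obtain ⟨x, y⟩ := z
  obtain ⟨x', y'⟩ := z'
  rcases l with ⟨a, b⟩ | c <;> simp only [OnLine, Sum.elim_inl, Sum.elim_inr] at h1 h2 h
  · rw [h1, h2, h]
  · rw [h1, h2, h]

/-- An `s`-cover formed by `s - 2` disjoint lines and part of an affine plane. -/
theorem exists_cover_of_plane (F : Type*) [Field F] [Fintype F] [DecidableEq F] (s k m : ℕ)
    (hs : 2 ≤ s) (hm : m ≤ Fintype.card F ^ 2) (hk : Fintype.card F ≤ k) (X : Type*) [Fintype X]
    [DecidableEq X] (hX : Fintype.card X = (s - 2) * k + m) :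
    ∃ L : Finset (Finset X), IsSCover s L ∧ (∀ A ∈ L, A.card ≤ k) ∧
      L.card ≤ (s - 2) + (Fintype.card F ^ 2 + Fintype.card F) := by
  obtain ⟨t, rfl⟩ := Nat.exists_eq_add_of_le' hs
  rw [Nat.add_sub_cancel] at *
  let Y := (Fin t × Fin k) ⊕ Fin m
  have e : Y ≃ X := Fintype.equivOfCardEq (by simp [Y, hX])
  obtain ⟨g⟩ : Nonempty (Fin m ↪ F × F) :=
    Function.Embedding.nonempty_of_card_le (by simpa [sq] using hm)
  let trace : (F × F) ⊕ F → Finset Y := fun l =>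
    (Finset.univ.filter fun a => OnLine l (g a)).image Sum.inr
  let plane : Finset (Finset Y) := Finset.univ.image trace
  have hplane : ∀ A, A ∈ plane ↔ ∃ l, trace l = A := by intro A; simp [plane]
  have htrace : ∀ l x, x ∈ trace l ↔ ∃ a, OnLine l (g a) ∧ Sum.inr a = x := by
    intro l x; simp [trace]
  have hlin : IsLinear (parallelLines t k (Fin m) ∪ plane) := by
    refine isLinear_union isLinear_parallelLines ?_ ?_
    · intro A hA B hB hAB
      obtain ⟨l, rfl⟩ := (hplane _).1 hA
      obtain ⟨l', rfl⟩ := (hplane _).1 hB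
      rw [Finset.card_le_one]
      intro x hx y hy
      rw [Finset.mem_inter, htrace, htrace] at hx hy
      obtain ⟨⟨a, ha, rfl⟩, a', ha', haa'⟩ := hx
      obtain ⟨⟨b, hb, rfl⟩, b', hb', hbb'⟩ := hy
      rw [Sum.inr.injEq] at haa' hbb'
      subst haa' hbb'
      by_contra hne
      exact hAB (congrArg trace (onLine_unique (fun h => hne (by rw [g.injective h])) ha hb ha' hb'))
    · intro A hA B hB
      obtain ⟨i, rfl⟩ := mem_parallelLines.1 hA
      obtain ⟨l, rfl⟩ := (hplane _).1 hB
      rw [Finset.card_le_one]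
      intro x hx
      rw [Finset.mem_inter, htrace, Finset.mem_image] at hx
      obtain ⟨⟨a, -, rfl⟩, b, -, hb⟩ := hx
      exact absurd hb Sum.inr_ne_inl
  have hcov : IsSCover (t + 2) (parallelLines t k (Fin m) ∪ plane) := by
    -- One class per parallel line and one for the plane: t + 1 classes.
    refine isSCover_of_partition hlin (Sum.elim (fun x => some x.1) fun _ => none) (by simp) ?_
    rintro (⟨i, a⟩ | u) (⟨j, b⟩ | v) hxy hf
    · simp only [Sum.elim_inl, Option.some.injEq] at hf
      subst hf
      exact ⟨_, Finset.mem_union_left _ (mem_parallelLines.2 ⟨i, rfl⟩), by simp, by simp⟩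
    · simp at hf
    · simp at hf
    · obtain ⟨l, hu, hv⟩ := exists_onLine (g u) (g v)
      exact ⟨trace l, Finset.mem_union_right _ ((hplane _).2 ⟨l, rfl⟩),
        (htrace _ _).2 ⟨u, hu, rfl⟩, (htrace _ _).2 ⟨v, hv, rfl⟩⟩
  refine ⟨mapLines e (parallelLines t k (Fin m) ∪ plane), hcov.mapLines e, ?_, ?_⟩
  · intro A hA
    obtain ⟨B, hB, rfl⟩ := mem_mapLines.1 hA
    rw [Finset.card_map]
    rcases Finset.mem_union.1 hB with hB | hB
    · exact (card_of_mem_parallelLines hB).le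
    · obtain ⟨l, rfl⟩ := (hplane _).1 hB
      refine le_trans (Finset.card_image_le.trans ?_) hk
      refine Finset.card_le_card_of_injOn
        (fun a => Sum.elim (fun _ => (g a).1) (fun _ => (g a).2) l) (fun _ _ => Finset.mem_univ _) ?_
      intro a ha b hb hab
      simp only [Finset.coe_filter, Finset.mem_univ, true_and, Set.mem_ofPred_eq] at ha hb
      exact g.injective (onLine_injOn ha hb hab)
  · rw [card_mapLines]
    refine (Finset.card_union_le _ _).trans (Nat.add_le_add ?_ ?_)
    · exact Finset.card_image_le.trans (by simp)
    · exact Finset.card_image_le.trans (by simp [sq])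

end

end SCover

/-! ### Primes in [x, (1 + δ)x]: the Fejér kernel and the analytic input. -/

namespace PrimeGap

open Filter Topology MeasureTheory

/-- The Fejér kernel, as the cosine transform of a triangle function. -/
noncomputable def fejer (T u : ℝ) : ℝ := 2 * ∫ t in (0 : ℝ)..T, (1 - t / T) * Real.cos (t * u)

lemma fejer_eq {T u : ℝ} (hT : 0 < T) (hu : u ≠ 0) :
    fejer T u = 2 * (1 - Real.cos (T * u)) / (T * u ^ 2) := by
  have hd : ∀ t ∈ Set.uIcc 0 T, HasDerivAt
      (fun t => (1 - t / T) * (Real.sin (t * u) / u) - Real.cos (t * u) / (T * u ^ 2))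
      ((1 - t / T) * Real.cos (t * u)) t := by
    intro t _
    have h1 : HasDerivAt (fun t : ℝ => t * u) u t := by simpa using (hasDerivAt_id t).mul_const u
    have h2 : HasDerivAt (fun t : ℝ => 1 - t / T) (-(1 / T)) t := by
      simpa using ((hasDerivAt_id t).div_const T).const_sub 1
    have h3 := (h2.mul (h1.sin.div_const u)).sub (h1.cos.div_const (T * u ^ 2))
    refine h3.congr_deriv ?_
    field_simp
    ring
  rw [fejer, intervalIntegral.integral_eq_sub_of_hasDerivAt hd
    (Continuous.intervalIntegrable (by fun_prop) _ _)]
  have hT' := hT.ne'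
  simp only [zero_mul, Real.sin_zero, Real.cos_zero, zero_div, mul_zero, div_self hT', sub_self,
    zero_sub]
  field_simp
  ring

lemma integral_triangle {T : ℝ} (hT : 0 < T) : ∫ t in (0 : ℝ)..T, (1 - t / T) = T / 2 := by
  rw [intervalIntegral.integral_sub (by simp) (Continuous.intervalIntegrable (by fun_prop) _ _)]
  simp only [intervalIntegral.integral_const, intervalIntegral.integral_div, integral_id, sub_zero,
    smul_eq_mul, mul_one]
  field_simp
  ring

lemma fejer_zero {T : ℝ} (hT : 0 < T) : fejer T 0 = T := by
  simp only [fejer, mul_zero, Real.cos_zero, mul_one, integral_triangle hT]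
  ring

lemma fejer_nonneg {T : ℝ} (hT : 0 < T) (u : ℝ) : 0 ≤ fejer T u := by
  rcases eq_or_ne u 0 with rfl | hu
  · rw [fejer_zero hT]; exact hT.le
  · rw [fejer_eq hT hu]
    have := Real.cos_le_one (T * u)
    exact div_nonneg (by linarith) (by positivity)

lemma fejer_le {T : ℝ} (hT : 0 < T) (u : ℝ) : fejer T u ≤ T := by
  have : ∫ t in (0 : ℝ)..T, (1 - t / T) * Real.cos (t * u) ≤ ∫ t in (0 : ℝ)..T, (1 - t / T) := by
    refine intervalIntegral.integral_mono_on hT.le (Continuous.intervalIntegrable (by fun_prop) _ _)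
      (Continuous.intervalIntegrable (by fun_prop) _ _) fun t ht => ?_
    refine mul_le_of_le_one_right ?_ (Real.cos_le_one _)
    rw [sub_nonneg, div_le_one hT]
    exact ht.2
  rw [integral_triangle hT] at this
  rw [fejer]
  linarith

lemma fejer_le_div {T u : ℝ} (hT : 0 < T) (hu : u ≠ 0) : fejer T u ≤ 4 / (T * u ^ 2) := by
  rw [fejer_eq hT hu]
  have := Real.neg_one_le_cos (T * u)
  gcongr
  linarith

/-- Here cos(tu) ≥ 1/2 throughout, since |tu| ≤ 1. -/
lemma le_fejer {T u : ℝ} (hT : 0 < T) (hu : |u| ≤ 1 / T) : T / 2 ≤ fejer T u := by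
  have : ∫ t in (0 : ℝ)..T, (1 - t / T) * (1 / 2) ≤
      ∫ t in (0 : ℝ)..T, (1 - t / T) * Real.cos (t * u) := by
    refine intervalIntegral.integral_mono_on hT.le (Continuous.intervalIntegrable (by fun_prop) _ _)
      (Continuous.intervalIntegrable (by fun_prop) _ _) fun t ht => ?_
    refine mul_le_mul_of_nonneg_left ?_ (by rw [sub_nonneg, div_le_one hT]; exact ht.2)
    have h1 : |t * u| ≤ 1 := by
      rw [abs_mul, abs_of_nonneg ht.1]
      calc t * |u| ≤ T * (1 / T) := mul_le_mul ht.2 hu (abs_nonneg _) hT.le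
        _ = 1 := by field_simp
    have h2 := Real.one_sub_sq_div_two_le_cos (x := t * u)
    have h3 : (t * u) ^ 2 ≤ 1 := by
      rw [← sq_abs]
      exact pow_le_one₀ (abs_nonneg _) h1
    linarith
  rw [intervalIntegral.integral_mul_const, integral_triangle hT] at this
  rw [fejer]
  linarith

section

open ArithmeticFunction Chebyshev

lemma summable_one_div_one_add_sq : Summable fun j : ℤ => 1 / (1 + (j : ℝ) ^ 2) := by
  refine Summable.of_norm_bounded_eventually (g := fun j : ℤ => 1 / (j : ℝ) ^ 2)
    (Real.summable_one_div_int_pow.2 one_lt_two) ?_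
  filter_upwards [(Set.finite_singleton (0 : ℤ)).compl_mem_cofinite] with j hj
  have hj' : (j : ℝ) ≠ 0 := by exact_mod_cast hj
  rw [Real.norm_of_nonneg (by positivity)]
  gcongr
  linarith

/-- A uniform bound for a smoothed sum of `Λ n / n`, from Chebyshev's upper bound. -/
lemma exists_smoothed_bound : ∃ C : ℝ, 0 ≤ C ∧ ∀ (y : ℝ) (s : Finset ℕ),
    ∑ n ∈ s, vonMangoldt n / n * (1 / (1 + (Real.log n - y) ^ 2)) ≤ C := by
  set c := (Real.log 4 + 4) * Real.exp 1 with hc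
  have hc0 : 0 ≤ c := by positivity
  refine ⟨∑' j : ℤ, 3 * c * (1 / (1 + (j : ℝ) ^ 2)), tsum_nonneg fun j => by positivity,
    fun y s => ?_⟩
  classical
  have hsum := summable_one_div_one_add_sq.mul_left (3 * c)
  -- Group n by the integer part j of log n - y. Chebyshev's bound ψ(x) = O(x) makes the sum of
  -- Λ(n)/n over each group bounded by a constant, and the weight there is at most 3/(1 + j²).
  set J : ℕ → ℤ := fun n => ⌊Real.log n - y⌋ with hJ
  rw [← Finset.sum_fiberwise_of_maps_to (g := J) (t := s.image J)
    (fun n hn => Finset.mem_image_of_mem _ hn)]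
  refine le_trans (Finset.sum_le_sum fun j _ => ?_) (hsum.sum_le_tsum _ fun j _ => by positivity)
  have h1 : ∀ n ∈ s.filter (fun n => J n = j),
      vonMangoldt n / n * (1 / (1 + (Real.log n - y) ^ 2)) ≤
      vonMangoldt n * Real.exp (-(y + j)) * (3 * (1 / (1 + (j : ℝ) ^ 2))) := by
    intro n hn
    have hn' := (Finset.mem_filter.1 hn).2
    rcases Nat.eq_zero_or_pos n with rfl | hn0
    · simp
    have hn0' : (0 : ℝ) < n := by exact_mod_cast hn0
    have h2 : (j : ℝ) ≤ Real.log n - y := by rw [← hn']; exact Int.floor_le _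
    have h3 : Real.log n - y < j + 1 := by rw [← hn']; exact Int.lt_floor_add_one _
    rw [div_eq_mul_inv]
    refine mul_le_mul (mul_le_mul_of_nonneg_left ?_ vonMangoldt_nonneg) ?_ (by positivity)
      (mul_nonneg vonMangoldt_nonneg (Real.exp_nonneg _))
    · rw [Real.exp_neg]
      refine inv_anti₀ (Real.exp_pos _) ?_
      rw [← Real.le_log_iff_exp_le hn0']
      linarith
    · rw [mul_one_div, div_le_div_iff₀ (by positivity) (by positivity)]
      nlinarith [sq_nonneg (Real.log n - y), sq_nonneg (Real.log n - y - j),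
        sq_nonneg (Real.log n - y + (Real.log n - y - j))]
  refine (Finset.sum_le_sum h1).trans ?_
  rw [← Finset.sum_mul, ← Finset.sum_mul]
  have h4 : ∑ n ∈ s.filter (fun n => J n = j), vonMangoldt n ≤ psi (Real.exp (y + j + 1)) := by
    rw [psi_eq_sum_Icc]
    refine Finset.sum_le_sum_of_subset_of_nonneg (fun n hn => ?_) fun _ _ _ => vonMangoldt_nonneg
    have hn' := (Finset.mem_filter.1 hn).2
    rw [Finset.mem_Icc]
    refine ⟨Nat.zero_le _, Nat.le_floor ?_⟩
    rcases Nat.eq_zero_or_pos n with rfl | hn0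
    · simpa using Real.exp_nonneg _
    · have h3 : Real.log n - y < j + 1 := by rw [← hn']; exact Int.lt_floor_add_one _
      rw [← Real.log_le_iff_le_exp (by exact_mod_cast hn0)]
      linarith
  have h5 : (∑ n ∈ s.filter (fun n => J n = j), vonMangoldt n) * Real.exp (-(y + j)) ≤ c := by
    calc _ ≤ (Real.log 4 + 4) * Real.exp (y + j + 1) * Real.exp (-(y + j)) :=
          mul_le_mul_of_nonneg_right (h4.trans (psi_le_const_mul_self (Real.exp_nonneg _)))
            (Real.exp_nonneg _)
      _ = c := by
          rw [mul_assoc, ← Real.exp_add, hc]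
          congr 2
          ring
  calc _ ≤ c * (3 * (1 / (1 + (j : ℝ) ^ 2))) := mul_le_mul_of_nonneg_right h5 (by positivity)
    _ = _ := by ring

open scoped LSeries.notation in
/-- `-ζ'/ζ - ζ` extends continuously to the closed half plane. -/
lemma exists_continuous_extension : ∃ H : ℂ → ℂ, ContinuousOn H {s | 1 ≤ s.re} ∧
    ∀ s : ℂ, 1 < s.re → H s = LSeries ((↗vonMangoldt) - 1) s ∧
      LSeriesSummable ((↗vonMangoldt) - 1) s := by
  set Z : ℂ → ℂ := Function.update (fun s => riemannZeta s - 1 / (s - 1)) 1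
    Real.eulerMascheroniConstant with hZ
  have hZc : Continuous Z := by
    rw [continuous_iff_continuousAt]
    intro s
    rcases eq_or_ne s 1 with rfl | hs
    · rw [hZ, continuousAt_update_same]
      exact tendsto_riemannZeta_sub_one_div
    · have h1 : ContinuousAt (fun s => riemannZeta s - 1 / (s - 1)) s := by
        refine (differentiableAt_riemannZeta hs).continuousAt.sub ?_
        exact ContinuousAt.div continuousAt_const (by fun_prop) (sub_ne_zero.2 hs)
      rwa [hZ, continuousAt_update_of_ne hs]
  -- For modulus 1 the auxiliary function is -ζ'/ζ minus its pole at 1, and its continuity on re s ≥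
  -- 1 embodies the non-vanishing of ζ on the line. `Z` is ζ minus the same pole, so the poles
  -- cancel in the difference.
  refine ⟨fun s => vonMangoldt.LFunctionResidueClassAux (q := 1) 1 s - Z s,
    (vonMangoldt.continuousOn_LFunctionResidueClassAux (q := 1) 1).sub hZc.continuousOn,
    fun s hs => ?_⟩
  have hs1 : s ≠ 1 := by rintro rfl; simp at hs
  have h1 := LSeriesSummable_vonMangoldt hs
  have h2 : LSeriesSummable 1 s := LSeriesSummable_one_iff.2 hs
  refine ⟨?_, h1.sub h2⟩
  have h3 : (fun n : ℕ => ((vonMangoldt.residueClass (1 : ZMod 1) n : ℝ) : ℂ)) =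
      fun n : ℕ => ((vonMangoldt n : ℝ) : ℂ) := by
    ext n
    simp [vonMangoldt.residueClass, Set.indicator, Subsingleton.elim (n : ZMod 1) 1]
  simp only [vonMangoldt.eqOn_LFunctionResidueClassAux isUnit_one hs, h3]
  rw [LSeries_sub h1 h2, LSeries_one_eq_riemannZeta hs, hZ, Function.update_of_ne hs1]
  simp

end

end PrimeGap

/-! ### The smoothed sum as a vertical integral, and its limits. -/

namespace PrimeGap

open Filter Topology MeasureTheory ArithmeticFunction

open scoped LSeries.notation in
/-- The smoothed sum of the coefficients `Λ n - 1` as an integral of the Dirichlet series. -/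
lemma hasSum_smoothed {H : ℂ → ℂ} (hH : ∀ s : ℂ, 1 < s.re →
    H s = LSeries ((↗vonMangoldt) - 1) s ∧ LSeriesSummable ((↗vonMangoldt) - 1) s)
    {T σ : ℝ} (hT : 0 < T) (hσ : 1 < σ) (y : ℝ) :
    HasSum (fun n : ℕ => (vonMangoldt n - 1) * (n : ℝ) ^ (-σ) * fejer T (Real.log n - y))
      (2 * (∫ t in (0 : ℝ)..T, ((1 - t / T : ℝ) : ℂ) * Complex.exp (Complex.I * (t * y)) *
        H (σ + Complex.I * t)).re) := by
  have hre : ∀ t : ℝ, ((σ : ℂ) + Complex.I * t).re = σ := fun t => by simp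
  set f : ℕ → ℂ := (↗vonMangoldt) - 1 with hf
  have hσ1 : 1 < ((σ : ℂ)).re := by simpa using hσ
  set F : ℕ → ℝ → ℂ := fun n t => ((1 - t / T : ℝ) : ℂ) * Complex.exp (Complex.I * (t * y)) *
    LSeries.term f (σ + Complex.I * t) n with hF
  have hFn : ∀ n : ℕ, n ≠ 0 → F n = fun t : ℝ => ((1 - t / T : ℝ) : ℂ) *
      ((((vonMangoldt n - 1) * (n : ℝ) ^ (-σ) : ℝ) : ℂ) *
        Complex.exp (((t * (y - Real.log n) : ℝ) : ℂ) * Complex.I)) := by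
    intro n hn
    have hn' : (n : ℂ) ≠ 0 := by exact_mod_cast hn
    ext t
    have h1 : LSeries.term f (σ + Complex.I * t) n = (((vonMangoldt n - 1) * (n : ℝ) ^ (-σ) : ℝ) : ℂ) *
        Complex.exp (-(t * Real.log n : ℝ) * Complex.I) := by
      rw [LSeries.term_of_ne_zero hn, div_eq_mul_inv, ← Complex.cpow_neg, neg_add,
        Complex.cpow_add _ _ hn', Complex.cpow_def_of_ne_zero hn' (-(Complex.I * t)),
        ← Complex.natCast_log]
      push_cast
      rw [Complex.ofReal_cpow (Nat.cast_nonneg n)]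
      push_cast
      rw [← mul_assoc]
      congr 1
      congr 1
      ring
    simp only [hF, h1]
    have h2 : Complex.exp (((t * (y - Real.log n) : ℝ) : ℂ) * Complex.I) =
        Complex.exp (Complex.I * (t * y)) * Complex.exp (-(t * Real.log n : ℝ) * Complex.I) := by
      rw [← Complex.exp_add]
      congr 1
      push_cast
      ring
    rw [h2]
    ring
  have hF0 : F 0 = fun _ => 0 := by
    ext t
    simp [hF]
  have hFc : ∀ n, Continuous (F n) := by
    intro n
    rcases eq_or_ne n 0 with rfl | hn
    · rw [hF0]; exact continuous_const
    · rw [hFn n hn]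
      fun_prop
  -- The norm does not depend on t, so absolute convergence at σ dominates the series on the whole
  -- segment.
  have hterm : ∀ n (t : ℝ), ‖LSeries.term f (σ + Complex.I * t) n‖ = ‖LSeries.term f σ n‖ := by
    intro n t
    rw [LSeries.norm_term_eq, LSeries.norm_term_eq, hre, Complex.ofReal_re]
  have hsum := intervalIntegral.hasSum_integral_of_dominated_convergence (μ := volume) (a := 0)
    (b := T) (F := F) (f := fun t : ℝ => ((1 - t / T : ℝ) : ℂ) *
      Complex.exp (Complex.I * (t * y)) * H (σ + Complex.I * t))
    (fun n _ => ‖LSeries.term f σ n‖) (fun n => (hFc n).aestronglyMeasurable)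
    (fun n => Eventually.of_forall fun t ht => by
      rw [Set.uIoc_of_le hT.le] at ht
      have h1 : ‖((1 - t / T : ℝ) : ℂ)‖ ≤ 1 := by
        rw [Complex.norm_real, Real.norm_eq_abs, abs_le]
        have h2 : t / T ≤ 1 := (div_le_one hT).2 ht.2
        have h3 : 0 ≤ t / T := div_nonneg ht.1.le hT.le
        constructor <;> linarith
      have h2 : ‖Complex.exp (Complex.I * (t * y))‖ = 1 := by
        rw [mul_comm, ← Complex.ofReal_mul, Complex.norm_exp_ofReal_mul_I]
      rw [hF, norm_mul, norm_mul, h2, mul_one, hterm]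
      exact mul_le_of_le_one_left (norm_nonneg _) h1)
    (Eventually.of_forall fun _ _ => ((hH σ hσ1).2).norm)
    (by simp)
    (Eventually.of_forall fun t _ => by
      have h := hH (σ + Complex.I * t) (by rw [hre]; exact hσ)
      rw [h.1]
      exact (h.2.hasSum).mul_left _)
  have hsum2 := (Complex.hasSum_re hsum).mul_left 2
  refine hsum2.congr_fun fun n => ?_
  rcases eq_or_ne n 0 with rfl | hn
  · simp [hF0, Real.zero_rpow (by linarith : -σ ≠ 0)]
  have h1 : (∫ t in (0 : ℝ)..T, F n t).re = ∫ t in (0 : ℝ)..T, (F n t).re :=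
    (Complex.reCLM.intervalIntegral_comp_comm ((hFc n).intervalIntegrable 0 T)).symm
  have h2 : ∀ t, (F n t).re = (vonMangoldt n - 1) * (n : ℝ) ^ (-σ) *
      ((1 - t / T) * Real.cos (t * (Real.log n - y))) := by
    intro t
    rw [hFn n hn, Complex.re_ofReal_mul, Complex.re_ofReal_mul, Complex.exp_ofReal_mul_I_re,
      ← Real.cos_neg (t * (y - Real.log n)), ← mul_neg, neg_sub]
    ring
  rw [h1]
  simp only [h2]
  rw [intervalIntegral.integral_const_mul, fejer]
  ring

/-- The integral of a function continuous on `1 ≤ re s` over vertical segments is continuous up to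
the boundary. -/
lemma tendsto_vertical_integral {H : ℂ → ℂ} (hH : ContinuousOn H {s | 1 ≤ s.re}) (T y : ℝ) :
    Tendsto (fun σ : ℝ => ∫ t in (0 : ℝ)..T, ((1 - t / T : ℝ) : ℂ) *
        Complex.exp (Complex.I * (t * y)) * H (σ + Complex.I * t)) (𝓝[>] 1)
      (𝓝 (∫ t in (0 : ℝ)..T, ((1 - t / T : ℝ) : ℂ) * Complex.exp (Complex.I * (t * y)) *
        H (1 + Complex.I * t))) := by
  -- Clamping σ at 1 yields a function continuous on the whole plane that agrees with `H` for σ ≥ 1.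
  have hc : Continuous fun p : ℝ × ℝ => H ((max p.1 1 : ℝ) + Complex.I * p.2) :=
    hH.comp_continuous (by fun_prop) fun p => by simp
  have hc2 : Continuous fun σ : ℝ => ∫ t in (0 : ℝ)..T, ((1 - t / T : ℝ) : ℂ) *
      Complex.exp (Complex.I * (t * y)) * H ((max σ 1 : ℝ) + Complex.I * t) := by
    refine intervalIntegral.continuous_parametric_intervalIntegral_of_continuous' ?_ 0 T
    refine Continuous.mul (by fun_prop) hc
  have h := (hc2.tendsto 1).mono_left (nhdsWithin_le_nhds (s := Set.Ioi 1))
  simp only [max_self, Complex.ofReal_one] at h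
  refine h.congr' ?_
  filter_upwards [self_mem_nhdsWithin] with σ hσ
  rw [max_eq_left (le_of_lt hσ)]

/-- Riemann–Lebesgue for the integrand cut off to (0, T]; the frequency -y/(2π) matches the
normalisation of the Fourier character. -/
lemma tendsto_vertical_integral_atTop {H : ℂ → ℂ} {T : ℝ} (hT : 0 < T) :
    Tendsto (fun y : ℝ => ∫ t in (0 : ℝ)..T, ((1 - t / T : ℝ) : ℂ) *
        Complex.exp (Complex.I * (t * y)) * H (1 + Complex.I * t)) atTop (𝓝 0) := by
  have h := Real.tendsto_integral_exp_smul_cocompact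
    ((Set.Ioc 0 T).indicator fun t : ℝ => ((1 - t / T : ℝ) : ℂ) * H (1 + Complex.I * t))
  have hw : Tendsto (fun y : ℝ => -y / (2 * Real.pi)) atTop (cocompact ℝ) := by
    have : Tendsto (fun y : ℝ => -y / (2 * Real.pi)) atTop atBot :=
      tendsto_neg_atTop_atBot.atBot_div_const (by positivity)
    exact this.mono_right atBot_le_cocompact
  refine (h.comp hw).congr fun y => ?_
  rw [intervalIntegral.integral_of_le hT.le, ← integral_indicator measurableSet_Ioc]
  refine integral_congr_ae (Eventually.of_forall fun t => ?_)
  by_cases ht : t ∈ Set.Ioc 0 T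
  · simp only [Set.indicator_of_mem ht, Circle.smul_def, Real.fourierChar_apply, smul_eq_mul]
    have : ((2 * Real.pi * -(t * (-y / (2 * Real.pi))) : ℝ) : ℂ) * Complex.I =
        Complex.I * (t * y) := by
      have : 2 * Real.pi * -(t * (-y / (2 * Real.pi))) = t * y := by
        field_simp
      rw [this]
      push_cast
      ring
    rw [this]
    ring
  · simp [Set.indicator_of_notMem ht]

end PrimeGap

/-! ### Primes near every large logarithm. -/

namespace PrimeGap

open Filter Topology MeasureTheory ArithmeticFunction

lemma summable_nonprime : Summable fun n : ℕ => (if n.Prime then 0 else vonMangoldt n) / n := by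
  have h := vonMangoldt.summable_residueClass_non_primes_div (q := 1) 1
  refine h.congr fun n => ?_
  have : vonMangoldt.residueClass (1 : ZMod 1) n = vonMangoldt n := by
    rw [vonMangoldt.residueClass, Set.indicator_of_mem]
    exact Subsingleton.elim _ _
  rw [this]

lemma exists_nonprime_tail {η : ℝ} (hη : 0 < η) : ∃ N : ℕ, ∀ s : Finset ℕ, (∀ n ∈ s, N ≤ n) →
    ∑ n ∈ s, (if n.Prime then 0 else vonMangoldt n) / n ≤ η := by
  obtain ⟨u, hu⟩ := (summable_iff_vanishing_norm.1 summable_nonprime) η hη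
  obtain ⟨N, hN⟩ := u.bddAbove
  refine ⟨N + 1, fun s hs => ?_⟩
  refine (le_abs_self _).trans (hu s ?_).le
  rw [Finset.disjoint_left]
  intro n hn hnu
  have := hN hnu
  have := hs n hn
  omega

/-- Without primes near e^y, the terms with log n within δ of y come from proper prime powers, whose
tail is at most η; farther away the kernel decays like 4/(Tu²) and the Chebyshev bound `C` applies.
-/
lemma sum_le_of_forall_prime_far {T δ y η C : ℝ} {N : ℕ} (hT : 0 < T) (hδ : 0 < δ)
    (hC : ∀ s : Finset ℕ, ∑ n ∈ s, vonMangoldt n / n * (1 / (1 + (Real.log n - y) ^ 2)) ≤ C)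
    (hN : ∀ s : Finset ℕ, (∀ n ∈ s, N ≤ n) →
      ∑ n ∈ s, (if n.Prime then 0 else vonMangoldt n) / n ≤ η)
    (hy : δ + Real.log N < y) (hfar : ∀ p : ℕ, p.Prime → δ < |Real.log p - y|) (s : Finset ℕ) :
    ∑ n ∈ s, vonMangoldt n / n * fejer T (Real.log n - y) ≤
      T * η + 4 / T * (1 + 1 / δ ^ 2) * C := by
  rw [← Finset.sum_filter_add_sum_filter_not s fun n : ℕ => |Real.log n - y| ≤ δ]
  have hΛ : ∀ n : ℕ, 0 ≤ vonMangoldt n / n := fun n =>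
    div_nonneg vonMangoldt_nonneg (Nat.cast_nonneg n)
  refine add_le_add ?_ ?_
  · refine le_trans ?_ (mul_le_mul_of_nonneg_left (hN (s.filter fun n : ℕ => |Real.log n - y| ≤ δ)
      fun n hn => ?_) hT.le)
    · rw [Finset.mul_sum]
      refine Finset.sum_le_sum fun n hn => ?_
      have hp : ¬ n.Prime := fun hp => absurd (Finset.mem_filter.1 hn).2 (not_le.2 (hfar n hp))
      rw [if_neg hp, mul_comm]
      exact mul_le_mul_of_nonneg_right (fejer_le hT _) (hΛ n)
    · by_contra! hlt
      have h1 := (abs_le.1 (Finset.mem_filter.1 hn).2).1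
      have h2 : Real.log n ≤ Real.log N := by
        rcases Nat.eq_zero_or_pos n with rfl | hn0
        · simpa using Real.log_natCast_nonneg N
        · exact Real.log_le_log (by exact_mod_cast hn0) (by exact_mod_cast hlt.le)
      linarith
  · refine le_trans ?_ (mul_le_mul_of_nonneg_left (hC (s.filter fun n : ℕ => ¬ |Real.log n - y| ≤ δ))
      (by positivity))
    rw [Finset.mul_sum]
    refine Finset.sum_le_sum fun n hn => ?_
    rw [← mul_assoc, mul_comm _ (vonMangoldt n / n), mul_assoc]
    refine mul_le_mul_of_nonneg_left ?_ (hΛ n)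
    set u := Real.log n - y with hu
    have h1 : δ < |u| := not_le.1 (Finset.mem_filter.1 hn).2
    have h2 : δ ^ 2 < u ^ 2 := by
      rw [← sq_abs u]
      exact pow_lt_pow_left₀ h1 hδ.le two_ne_zero
    have h3 : 0 < u ^ 2 := lt_trans (by positivity) h2
    have hu0 : u ≠ 0 := fun h => by simp [h] at h3
    have h4 : 1 / u ^ 2 ≤ 1 / δ ^ 2 := one_div_le_one_div_of_le (by positivity) h2.le
    calc fejer T u ≤ 4 / (T * u ^ 2) := fejer_le_div hT hu0
      _ = 4 / T * (1 + 1 / u ^ 2) * (1 / (1 + u ^ 2)) := by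
        field_simp
        ring
      _ ≤ 4 / T * (1 + 1 / δ ^ 2) * (1 / (1 + u ^ 2)) := by gcongr

/-- The interval (e^y, e^(y + 1/T)] contains at least e^y/(2T) integers, each contributing at least
(1/(3e^y))(T/2); the product is 1/12. -/
lemma exists_le_sum_fejer {T y : ℝ} (hT : 1 ≤ T) (hy : 2 * T ≤ Real.exp y) :
    ∃ I : Finset ℕ, 0 ∉ I ∧ 1 / 12 ≤ ∑ n ∈ I, (1 / n : ℝ) * fejer T (Real.log n - y) := by
  have hT0 : 0 < T := by linarith
  have hTi : 1 / T ≤ 1 := by rw [div_le_one hT0]; exact hT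
  have hey := Real.exp_pos y
  have hexp : Real.exp (y + 1 / T) ≤ 3 * Real.exp y := by
    rw [Real.exp_add, mul_comm]
    have : Real.exp (1 / T) ≤ Real.exp 1 := Real.exp_le_exp.2 hTi
    have := Real.exp_one_lt_d9
    exact mul_le_mul_of_nonneg_right (by linarith) hey.le
  refine ⟨Finset.Ioc ⌊Real.exp y⌋₊ ⌊Real.exp (y + 1 / T)⌋₊, by simp, ?_⟩
  have hcard : Real.exp y / (2 * T) ≤
      ((Finset.Ioc ⌊Real.exp y⌋₊ ⌊Real.exp (y + 1 / T)⌋₊).card : ℝ) := by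
    rw [Nat.card_Ioc]
    have h1 : Real.exp y * (1 / T) + Real.exp y ≤ Real.exp (y + 1 / T) := by
      rw [Real.exp_add]
      have := Real.add_one_le_exp (1 / T)
      nlinarith
    have h2 := Nat.lt_floor_add_one (Real.exp (y + 1 / T))
    have h3 := Nat.floor_le hey.le
    have h4 : (⌊Real.exp (y + 1 / T)⌋₊ : ℝ) ≤
        ((⌊Real.exp (y + 1 / T)⌋₊ - ⌊Real.exp y⌋₊ : ℕ) : ℝ) + ⌊Real.exp y⌋₊ := by
      exact_mod_cast le_tsub_add
    have h5 : 1 ≤ Real.exp y / (2 * T) := by rwa [le_div_iff₀ (by positivity), one_mul]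
    have h6 : Real.exp y * (1 / T) = 2 * (Real.exp y / (2 * T)) := by field_simp
    linarith
  have hterm : ∀ n ∈ Finset.Ioc ⌊Real.exp y⌋₊ ⌊Real.exp (y + 1 / T)⌋₊,
      1 / (3 * Real.exp y) * (T / 2) ≤ (1 / n : ℝ) * fejer T (Real.log n - y) := by
    intro n hn
    rw [Finset.mem_Ioc] at hn
    have hn1 : Real.exp y < n := (Nat.floor_lt hey.le).1 hn.1
    have hn2 : (n : ℝ) ≤ Real.exp (y + 1 / T) :=
      (Nat.le_floor_iff (Real.exp_pos _).le).1 hn.2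
    have hn0 : (0 : ℝ) < n := hey.trans hn1
    have hl1 : y < Real.log n := (Real.lt_log_iff_exp_lt hn0).2 hn1
    have hl2 : Real.log n ≤ y + 1 / T := (Real.log_le_iff_le_exp hn0).2 hn2
    refine mul_le_mul (one_div_le_one_div_of_le hn0 (hn2.trans hexp)) (le_fejer hT0 ?_)
      (by positivity) (by positivity)
    rw [abs_le]
    constructor <;> linarith
  calc (1 / 12 : ℝ) = Real.exp y / (2 * T) * (1 / (3 * Real.exp y) * (T / 2)) := by
        field_simp
        norm_num
    _ ≤ _ := mul_le_mul_of_nonneg_right hcard (by positivity)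
    _ ≤ _ := by
      rw [← nsmul_eq_mul]
      exact Finset.card_nsmul_le_sum _ _ _ hterm

/-- Every interval of length `2 * δ` far enough to the right contains the logarithm of a prime. -/
theorem exists_prime_log_near {δ : ℝ} (hδ : 0 < δ) :
    ∃ y₀ : ℝ, ∀ y, y₀ ≤ y → ∃ p : ℕ, p.Prime ∧ |Real.log p - y| ≤ δ := by
  obtain ⟨C, hC0, hC⟩ := exists_smoothed_bound
  obtain ⟨H, hHc, hH⟩ := exists_continuous_extension
  set B := (1 + 1 / δ ^ 2) * C with hB
  have hB0 : 0 ≤ B := by positivity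
  -- Chosen so that the far part 4B/T is at most 1/32.
  set T := 1 + 128 * B with hTdef
  have hT1 : 1 ≤ T := by linarith
  have hT : 0 < T := by linarith
  have hTB : 4 / T * (1 + 1 / δ ^ 2) * C ≤ 1 / 32 := by
    rw [mul_assoc, ← hB, div_mul_eq_mul_div, div_le_iff₀ hT]
    linarith
  obtain ⟨N, hN⟩ := exists_nonprime_tail (η := 1 / (100 * T)) (by positivity)
  have hRL := (tendsto_vertical_integral_atTop (H := H) hT).norm
  rw [norm_zero] at hRL
  obtain ⟨y₁, hy₁⟩ := (eventually_atTop.1 (hRL.eventually (gt_mem_nhds (by norm_num : (0 : ℝ) < 1 / 200))))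
  obtain ⟨y₂, hy₂⟩ := eventually_atTop.1 (Real.tendsto_exp_atTop.eventually_ge_atTop (2 * T))
  refine ⟨max (max y₁ y₂) (δ + Real.log N + 1), fun y hy => ?_⟩
  simp only [max_le_iff] at hy
  by_contra! hfar
  obtain ⟨I, hI0, hI⟩ := exists_le_sum_fejer hT1 (hy₂ y hy.1.2)
  have hupper := sum_le_of_forall_prime_far hT hδ (hC y) hN (by linarith [hy.2]) hfar
  have hTη : T * (1 / (100 * T)) = 1 / 100 := by field_simp
  rw [hTη] at hupper
  set J : ℝ → ℂ := fun σ => ∫ t in (0 : ℝ)..T, ((1 - t / T : ℝ) : ℂ) *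
        Complex.exp (Complex.I * (t * y)) * H (σ + Complex.I * t) with hJ
  -- The Λ-part is bounded uniformly since n^(-σ) ≤ 1/n, and of the subtracted part only the indices
  -- in `I` are kept. At σ = 1 this gives 2 re J ≤ 1/100 + 1/32 - 1/12 < -1/100, whereas
  -- Riemann–Lebesgue gives |2J| < 1/100.
  have hσ : ∀ σ : ℝ, 1 < σ → 2 * (J σ).re ≤ 1 / 100 + 1 / 32 -
      ∑ n ∈ I, (n : ℝ) ^ (-σ) * fejer T (Real.log n - y) := by
    intro σ hσ
    refine le_of_tendsto (hasSum_smoothed hH hT hσ y) ?_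
    filter_upwards [eventually_ge_atTop I] with s hs
    have h1 : ∑ n ∈ s, vonMangoldt n * (n : ℝ) ^ (-σ) * fejer T (Real.log n - y) ≤
        ∑ n ∈ s, vonMangoldt n / n * fejer T (Real.log n - y) := by
      refine Finset.sum_le_sum fun n _ => mul_le_mul_of_nonneg_right ?_ (fejer_nonneg hT _)
      rcases Nat.eq_zero_or_pos n with rfl | hn
      · simp
      · rw [div_eq_mul_inv, ← Real.rpow_neg_one]
        exact mul_le_mul_of_nonneg_left (Real.rpow_le_rpow_of_exponent_le
          (by exact_mod_cast hn) (by linarith)) vonMangoldt_nonneg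
    have h2 : ∑ n ∈ I, (n : ℝ) ^ (-σ) * fejer T (Real.log n - y) ≤
        ∑ n ∈ s, (n : ℝ) ^ (-σ) * fejer T (Real.log n - y) :=
      Finset.sum_le_sum_of_subset_of_nonneg hs fun n _ _ =>
        mul_nonneg (Real.rpow_nonneg (Nat.cast_nonneg n) _) (fejer_nonneg hT _)
    simp only [sub_mul, one_mul, Finset.sum_sub_distrib]
    linarith [hupper s]
  have hlim1 : Tendsto (fun σ => 2 * (J σ).re) (𝓝[>] 1) (𝓝 (2 * (J 1).re)) := by
    have h := tendsto_vertical_integral hHc T y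
    have h2 := ((Complex.continuous_re.tendsto _).comp h).const_mul 2
    simpa [hJ, Function.comp_def] using h2
  have hlim2 : Tendsto (fun σ : ℝ => 1 / 100 + 1 / 32 -
      ∑ n ∈ I, (n : ℝ) ^ (-σ) * fejer T (Real.log n - y)) (𝓝[>] 1)
      (𝓝 (1 / 100 + 1 / 32 - ∑ n ∈ I, (1 / n : ℝ) * fejer T (Real.log n - y))) := by
    refine Tendsto.mono_left ?_ (nhdsWithin_le_nhds (s := Set.Ioi 1))
    refine tendsto_const_nhds.sub (tendsto_finsetSum _ fun n hn => Tendsto.mul_const _ ?_)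
    have hn0 : (n : ℝ) ≠ 0 := by
      rintro h
      exact hI0 (by rwa [Nat.cast_eq_zero.1 h] at hn)
    have hc : Continuous fun σ : ℝ => (n : ℝ) ^ (-σ) :=
      Real.continuous_const_rpow hn0 |>.comp continuous_neg
    have := hc.tendsto 1
    rwa [Real.rpow_neg_one, ← one_div] at this
  have hfinal := le_of_tendsto_of_tendsto hlim1 hlim2
    (by filter_upwards [self_mem_nhdsWithin] with σ h using hσ σ h)
  have hsmall : ‖J 1‖ < 1 / 200 := by
    have := hy₁ y hy.1.1
    simpa [hJ] using this
  have := (abs_le.1 (Complex.abs_re_le_norm (J 1))).1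
  linarith

/-- For every `δ > 0`, every interval `[x, (1 + δ) * x]` with `x` large contains a prime. -/
theorem exists_prime_between {δ : ℝ} (hδ : 0 < δ) :
    ∃ x₀ : ℝ, ∀ x, x₀ ≤ x → ∃ p : ℕ, p.Prime ∧ x ≤ p ∧ (p : ℝ) ≤ (1 + δ) * x := by
  have hl : 0 < Real.log (1 + δ) := Real.log_pos (by linarith)
  obtain ⟨y₀, hy₀⟩ := exists_prime_log_near (half_pos hl)
  refine ⟨Real.exp y₀, fun x hx => ?_⟩
  have hx0 : 0 < x := (Real.exp_pos _).trans_le hx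
  have hy : y₀ ≤ Real.log x := (Real.le_log_iff_exp_le hx0).2 hx
  obtain ⟨p, hp, h⟩ := hy₀ (Real.log x + Real.log (1 + δ) / 2) (by linarith)
  have hp0 : (0 : ℝ) < p := by exact_mod_cast hp.pos
  rw [abs_le] at h
  refine ⟨p, hp, (Real.log_le_log_iff hx0 hp0).1 (by linarith),
    (Real.log_le_log_iff hp0 (by positivity)).1 ?_⟩
  rw [Real.log_mul (by positivity) hx0.ne']
  linarith

end PrimeGap

/-! ### The asymptotic construction and the final assembly. -/

namespace SCover

/-- An `s`-cover with asymptotically `(n - 1) / (s - 1)` lines. -/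
lemma exists_cover_asymptotic {s : ℕ} (hs : 3 ≤ s) {ε : ℝ} (hε : 0 < ε) :
    ∃ N : ℕ, ∀ n : ℕ, N ≤ n → ¬ (s - 1) ∣ (n - 1) →
      ∀ (X : Type*) [Fintype X] [DecidableEq X], Fintype.card X = n →
      ∃ L : Finset (Finset X), IsSCover s L ∧
        (∀ A ∈ L, (A.card : ℝ) ≤ ((n : ℝ) - 1) / ((s : ℝ) - 1)) ∧
        (L.card : ℝ) ≤ (1 + ε) * (((n : ℝ) - 1) / ((s : ℝ) - 1) + (s : ℝ) - 1) := by
  -- Then (1 + δ)² ≤ 1 + 3δ ≤ 1 + ε/2, leaving ε/2 for the lower-order terms q and t.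
  set δ := min 1 (ε / 6) with hδ
  have hδ0 : 0 < δ := lt_min one_pos (by positivity)
  have hδ1 : δ ≤ 1 := min_le_left _ _
  have hδε : δ ≤ ε / 6 := min_le_right _ _
  obtain ⟨x₀, hx₀⟩ := PrimeGap.exists_prime_between hδ0
  set W := 16 / ε + s + 2 + |x₀| with hW
  have hW0 : 0 < W := by positivity
  refine ⟨⌈W ^ 2⌉₊ * s + 1, fun n hn hdvd X _ _ hX => ?_⟩
  obtain ⟨t, rfl⟩ : ∃ t, s = t + 2 := ⟨s - 2, by omega⟩
  have hst : t + 2 - 1 = t + 1 := rfl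
  rw [hst] at hdvd
  set k := (n - 1) / (t + 1) with hk
  set r := (n - 1) % (t + 1) with hr
  have hkr : (t + 1) * k + r = n - 1 := Nat.div_add_mod _ _
  have hrt : r < t + 1 := Nat.mod_lt _ (by omega)
  have hr0 : 0 < r := Nat.pos_of_ne_zero fun h => hdvd (Nat.dvd_of_mod_eq_zero h)
  have hn1 : 1 ≤ n := by omega
  -- With t = s - 2 disjoint lines of size k, these are the points left for the plane. Since r ≤ t,
  -- m is at most k + s - 1, and so at most the lower bound for the number of lines.
  set m := k + r + 1 with hm
  have hnm : n = t * k + m := by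
    have : (t + 1) * k = t * k + k := by ring
    omega
  have hnR : (n : ℝ) - 1 = (t + 1) * k + r := by
    have : n = (t + 1) * k + r + 1 := by omega
    rw [this]
    push_cast
    ring
  have hsR : ((t + 2 : ℕ) : ℝ) - 1 = t + 1 := by push_cast; ring
  have ht0 : (0 : ℝ) < t + 1 := by positivity
  set x := ((n : ℝ) - 1) / (((t + 2 : ℕ) : ℝ) - 1) with hx
  have hkx : (k : ℝ) ≤ x := by
    rw [hx, hsR, hnR, le_div_iff₀ ht0]
    nlinarith [(Nat.cast_nonneg r : (0 : ℝ) ≤ r)]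
  have hmx : W ^ 2 ≤ m := by
    have h1 : ⌈W ^ 2⌉₊ * (t + 1) ≤ n - 1 := by
      have : ⌈W ^ 2⌉₊ * (t + 1) ≤ ⌈W ^ 2⌉₊ * (t + 2) := Nat.mul_le_mul_left _ (by omega)
      omega
    have h2 : ⌈W ^ 2⌉₊ ≤ k := (Nat.le_div_iff_mul_le (by omega)).2 h1
    exact (Nat.le_ceil _).trans (by exact_mod_cast (by omega : ⌈W ^ 2⌉₊ ≤ m))
  set w := Real.sqrt m with hw
  have hw2 : w ^ 2 = m := Real.sq_sqrt (Nat.cast_nonneg m)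
  have hWw : W ≤ w := Real.le_sqrt_of_sq_le hmx
  have hεw : 16 ≤ ε * w := by
    have h0 : ε * (16 / ε) = 16 := by field_simp
    have h1 : 16 / ε ≤ w := by
      have := abs_nonneg x₀
      have : (0 : ℝ) ≤ ((t + 2 : ℕ) : ℝ) := Nat.cast_nonneg _
      linarith
    calc (16 : ℝ) = ε * (16 / ε) := h0.symm
      _ ≤ ε * w := by gcongr
  have hsw : ((t + 2 : ℕ) : ℝ) + 2 ≤ w := by
    have := abs_nonneg x₀
    have : (0 : ℝ) ≤ 16 / ε := by positivity
    linarith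
  have hx₀w : x₀ ≤ w := by
    have := le_abs_self x₀
    have : (0 : ℝ) ≤ 16 / ε := by positivity
    have : (0 : ℝ) ≤ ((t + 2 : ℕ) : ℝ) := Nat.cast_nonneg _
    linarith
  push_cast at hsw
  have htR : (0 : ℝ) ≤ t := Nat.cast_nonneg t
  have hmk : (m : ℝ) ≤ k + t + 1 := by exact_mod_cast (by omega : m ≤ k + t + 1)
  -- A plane of order q ≥ √m holds the m points, and q ≤ (1 + δ)√m keeps q² + q close to m.
  obtain ⟨q, hq, hq1, hq2⟩ := hx₀ w hx₀w
  have : Fact q.Prime := ⟨hq⟩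
  have hmq : m ≤ q ^ 2 := by
    have : (m : ℝ) ≤ (q : ℝ) ^ 2 := by
      rw [← hw2]
      exact pow_le_pow_left₀ (Real.sqrt_nonneg _) hq1 2
    exact_mod_cast this
  have hq2w : (q : ℝ) ≤ 2 * w := hq2.trans
    (mul_le_mul_of_nonneg_right (by linarith) (by linarith))
  have hqk : q ≤ k := by
    have h1 : (t + 4) * w ≤ w * w := mul_le_mul_of_nonneg_right (by linarith) (by linarith)
    have h2 : (t : ℝ) * 1 ≤ t * w := mul_le_mul_of_nonneg_left (by linarith) htR
    have : (q : ℝ) ≤ k := by linarith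
    exact_mod_cast this
  obtain ⟨L, hL, hLk, hLc⟩ := exists_cover_of_plane (ZMod q) (t + 2) k m (by omega)
    (by rwa [ZMod.card]) (by rwa [ZMod.card]) X (by rw [hX, hnm]; simp)
  refine ⟨L, hL, fun A hA => le_trans (by exact_mod_cast hLk A hA) hkx, ?_⟩
  rw [ZMod.card] at hLc
  have hLc' : (L.card : ℝ) ≤ t + ((q : ℝ) ^ 2 + q) := by exact_mod_cast hLc
  have hqq : (q : ℝ) ^ 2 ≤ (1 + ε / 2) * w ^ 2 := by
    calc (q : ℝ) ^ 2 ≤ ((1 + δ) * w) ^ 2 := pow_le_pow_left₀ (Nat.cast_nonneg q) hq2 2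
      _ = (1 + δ) ^ 2 * w ^ 2 := mul_pow _ _ _
      _ ≤ _ := by
        refine mul_le_mul_of_nonneg_right ?_ (sq_nonneg _)
        have : δ * δ ≤ δ * 1 := mul_le_mul_of_nonneg_left hδ1 hδ0.le
        linarith
  have hww : 16 * w ≤ ε * w ^ 2 := by
    have := mul_le_mul_of_nonneg_right hεw (by linarith : 0 ≤ w)
    linarith
  have hxw : w ^ 2 ≤ x + ((t + 2 : ℕ) : ℝ) - 1 := by
    push_cast
    linarith
  calc (L.card : ℝ) ≤ (1 + ε) * w ^ 2 := by linarith
    _ ≤ _ := mul_le_mul_of_nonneg_left hxw (by positivity)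

end SCover

theorem theorem2 (s : ℕ) (hs : 2 ≤ s) :
    -- lower bound, and the strict lower bound for `s ≥ 3`; `N` depends only on `s`
    (∃ N : ℕ, ∀ n : ℕ, N ≤ n →
      ∀ (X : Type*) [Fintype X] [DecidableEq X], Fintype.card X = n →
      ∀ L : Finset (Finset X), IsSCover s L →
        ((∀ A ∈ L, (A.card : ℝ) ≤ ((n : ℝ) - 1) / ((s : ℝ) - 1)) →
          ((n : ℝ) - 1) / ((s : ℝ) - 1) + (s : ℝ) - 1 ≤ (L.card : ℝ)) ∧
        (3 ≤ s → (∀ A ∈ L, (A.card : ℝ) ≤ ((n : ℝ) - 1) / ((s : ℝ) - 1) - 1) →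
          ((n : ℝ) - 1) / ((s : ℝ) - 1) + (s : ℝ) - 1 < (L.card : ℝ))) ∧
    -- tightness when `s - 1` divides `n - 1`
    (∃ N : ℕ, ∀ n : ℕ, N ≤ n → ((s : ℤ) - 1) ∣ ((n : ℤ) - 1) →
      ∀ (X : Type*) [Fintype X] [DecidableEq X], Fintype.card X = n →
      ∃ L : Finset (Finset X), IsSCover s L ∧
        (∀ A ∈ L, (A.card : ℝ) ≤ ((n : ℝ) - 1) / ((s : ℝ) - 1)) ∧
        (L.card : ℝ) = ((n : ℝ) - 1) / ((s : ℝ) - 1) + (s : ℝ) - 1) ∧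
    -- asymptotic tightness when `s - 1` does not divide `n - 1`
    (∀ ε : ℝ, 0 < ε → ∃ N : ℕ, ∀ n : ℕ, N ≤ n → ¬ ((s : ℤ) - 1) ∣ ((n : ℤ) - 1) →
      ∀ (X : Type*) [Fintype X] [DecidableEq X], Fintype.card X = n →
      ∃ L : Finset (Finset X), IsSCover s L ∧
        (∀ A ∈ L, (A.card : ℝ) ≤ ((n : ℝ) - 1) / ((s : ℝ) - 1)) ∧
        (L.card : ℝ) ≤ (1 + ε) * (((n : ℝ) - 1) / ((s : ℝ) - 1) + (s : ℝ) - 1)) := by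
  -- This threshold forces k ≥ 2, so that the two-point lines of the near-pencil are not too long.
  refine ⟨SCover.card_lower_bound s hs, ⟨2 * (s - 1) + 1, fun n hn hdvd X _ _ hX => ?_⟩,
    fun ε hε => ?_⟩
  · obtain ⟨t, rfl⟩ : ∃ t, s = t + 1 := ⟨s - 1, by omega⟩
    have hdvd' : t ∣ n - 1 := by
      have : ((t : ℕ) : ℤ) ∣ ((n - 1 : ℕ) : ℤ) := by
        rw [Nat.cast_sub (by omega)]
        simpa using hdvd
      exact_mod_cast this
    obtain ⟨k, hk⟩ := hdvd'
    simp only [Nat.add_sub_cancel] at hn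
    have hk2 : 2 ≤ k := by
      by_contra! h
      have : t * k ≤ t * 1 := Nat.mul_le_mul_left _ (by omega)
      omega
    have hn' : n = t * k + 1 := by omega
    have hkR : ((n : ℝ) - 1) / (((t + 1 : ℕ) : ℝ) - 1) = k := by
      have : (t : ℝ) ≠ 0 := by
        have : t ≠ 0 := by omega
        exact_mod_cast this
      rw [hn', div_eq_iff (by simpa using this)]
      push_cast
      ring
    obtain ⟨L, hL, hLk, hLc⟩ := SCover.exists_cover_of_eq (t + 1) k hs hk2 X (by rw [hX, hn']; simp)
    refine ⟨L, hL, fun A hA => ?_, ?_⟩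
    · rw [hkR]
      exact_mod_cast hLk A hA
    · rw [hkR, hLc]
      push_cast
      ring
  · rcases Nat.lt_or_ge 2 s with h | h
    · obtain ⟨N, hN⟩ := SCover.exists_cover_asymptotic h hε
      refine ⟨N + 1, fun n hn hdvd => hN n (by omega) fun hd => hdvd ?_⟩
      have h2 := Int.natCast_dvd_natCast.2 hd
      rwa [Nat.cast_sub (by omega), Nat.cast_sub (by omega), Nat.cast_one] at h2
    · obtain rfl : s = 2 := le_antisymm h hs
      -- For s = 2 the divisor s - 1 is 1, so the non-divisible case is vacuous.
      exact ⟨0, fun n _ hdvd => absurd (by norm_num) hdvd⟩
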